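/- \textbf{Setting.} Let $N,M\ge 1$, let $\mathcal R_1,\dots,\mathcal R_M\subseteq[N]$ be nonempty sets of servers (the storage pattern), $\rho_m=|\mathcal R_m|$, and let $X,T$ be integers with $0\le X<N$ and $1\le T<N$. For numbers of messages $K=(K_1,\dots,K_M)$, a \emph{scheme} for $X$-secure $T$-private linear computation with graph based replicated storage (GXSTPLC) consists of a finite field $\mathbb F_q$ and a message length $L\ge1$ (both chosen by the scheme) and of finitely valued random variables as follows, where $m$ ranges over $[M]$, $k$ over $[K_m]$ and $\ell$ over $[L]$. \begin{itemize} \item The messages $W_{m,k}=(W_{m,k}(\ell))_\ell\in\mathbb F_q^L$ consist of i.i.d. uniform symbols, and so do the coefficient vectors $\lambda_{m,k}=(\lambda_{m,k,(\ell)})_\ell\in\mathbb F_q^L$. Write $\mathcal W=(W_{m,k})_{m,k}$ and $\Lambda=(\lambda_{m,k})_{m,k}$. \item There are shares $\widetilde W^{(n)}_{m,k}$ and $\widetilde\lambda^{(n)}_{m,k}$ for $n\in\mathcal R_m$. Server $n$ stores $S_n=(\widetilde W^{(n)}_{m,k})_{m:\,n\in\mathcal R_m,\,k}$ and receives the query $Q_n=(\widetilde\lambda^{(n)}_{m,k})_{m:\,n\in\mathcal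 R_m,\,k}$. \item Recoverability: $H(W_{m,k}\mid(\widetilde W^{(n)}_{m,k})_{n\in\mathcal R_m})=0$ and $H(\lambda_{m,k}\mid(\widetilde\lambda^{(n)}_{m,k})_{n\in\mathcal R_m})=0$ for all $m,k$. \item Independent generation: the entropy of all the shares $\widetilde W^{(n)}_{m,k}$ together equals $\sum_{m,k}H((\widetilde W^{(n)}_{m,k})_{n\in\mathcal R_m})$, and likewise for the shares $\widetilde\lambda^{(n)}_{m,k}$. \item $X$-security: $I(S_{\mathcal X};\mathcal W)=0$ for all $\mathcal X\subseteq[N]$ with $|\mathcal X|=X$. $T$-privacy: $I(Q_{\mathcal T};\Lambda)=0$ for all $\mathcal T\subseteq[N]$ with $|\mathcal T|=T$. Moreover $I(S_{[N]};\Lambda,Q_{[N]})=0$. \item The answer $A_n$ of server $n$ is a string over $\mathbb F_q$, is a function of $(Q_n,S_n)$, and is self-delimiting: for each value of the query, the strings that server $n$ may return form a prefix-free set. \item Correctness: $H\big(\big(\sum_{m,k}\lambda_{m,k,(\ell)}W_{m,k}(\ell)\big)_{\ell}\,\big|\,A_{[N]},Q_{[N]},\Lambda\big)=0$. \end{itemize}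 The rate of a scheme is $L/D$, where $D$ is the expected total length of the $N$ answers. The capacity $C_K$ is the supremum of the rates of all schemes ($0$ if there is none), and the asymptotic capacity is $C_\infty=\lim_{K_1,\dots,K_M\to\infty}C_K$. \textbf{Theorem.} The limit $C_\infty$ exists, and $$C_\infty=\begin{cases}0,&\min_{m}\rho_m\le X+T,\\[2pt]\displaystyle\max_{(D_1,\dots,D_N)\in\mathcal D}\Big(\sum_{n\in[N]}D_n\Big)^{-1},&\min_m\rho_m>X+T,\end{cases}$$ where the maximum is attained and $\mathcal D$ is the set of $(D_1,\dots,D_N)\in\mathbb R_{\ge0}^N$ such that $\sum_{n\in\mathcal R'}D_n\ge1$ for all $m\in[M]$ and all $\mathcal R'\subseteq\mathcal R_m$ with $|\mathcal R'|=\rho_m-X-T$. -/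

import Mathlib

open Filter Topology
open scoped ENNReal

namespace GXSTPLC

noncomputable section

/-! ### Shannon entropy of random variables on a finite probability space

The unit is the nat.  Every entropic condition below is of the form `H = 0`, `I = 0` or
`H = ∑ H`, so that it does not depend on the base of the logarithm. -/

/-- Shannon entropy `H(Z) = - ∑ₓ P(Z = x) log P(Z = x)`.  The sample space is finite, so that
only finitely many terms are nonzero. -/
def entropy {Ω α : Type} [Fintype Ω] (p : PMF Ω) (Z : Ω → α) : ℝ :=
  ∑' x, Real.negMulLog (p.map Z x).toReal

/-- Conditional entropy `H(Y | Z) = H(Y, Z) - H(Z)`. -/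
def condEntropy {Ω α β : Type} [Fintype Ω] (p : PMF Ω) (Y : Ω → α) (Z : Ω → β) : ℝ :=
  entropy p (fun ω => (Y ω, Z ω)) - entropy p Z

/-- Mutual information `I(Y ; Z) = H(Y) + H(Z) - H(Y, Z)`. -/
def mutualInfo {Ω α β : Type} [Fintype Ω] (p : PMF Ω) (Y : Ω → α) (Z : Ω → β) : ℝ :=
  entropy p Y + entropy p Z - entropy p (fun ω => (Y ω, Z ω))

/-! ### The problem -/

/-- The indices `(m, k)` of the messages: the `m`-th message set has `K m` messages. -/
abbrev Msg {M : ℕ} (K : Fin M → ℕ) : Type := Σ m : Fin M, Fin (K m)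

/-- The indices of the messages that server `n` is allowed to store: those `(m, k)` with
`n ∈ R m`. -/
abbrev MsgAt {N M : ℕ} (R : Fin M → Finset (Fin N)) (K : Fin M → ℕ) (n : Fin N) : Type :=
  {j : Msg K // n ∈ R j.1}

/-- The desired linear combination: its `ℓ`-th symbol is
`∑_{m,k} λ_{m,k,(ℓ)} W_{m,k}(ℓ)`. -/
def linComb {M L : ℕ} {K : Fin M → ℕ} {F : Type} [Field F]
    (lam W : Msg K → Fin L → F) : Fin L → F :=
  fun ℓ => ∑ j, lam j ℓ * W j ℓ

/-- Given shares `sh` of all messages (or of all coefficient vectors), what is at server `n`: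
the shares with label `n` of the messages that server `n` is allowed to store. -/
def atServer {N M : ℕ} {R : Fin M → Finset (Fin N)} {K : Fin M → ℕ} {Ω α : Type}
    (sh : (j : Msg K) → {n // n ∈ R j.1} → Ω → α) (n : Fin N) (ω : Ω) :
    MsgAt R K n → α :=
  fun j => sh j.1 ⟨n, j.2⟩ ω

/-- What is jointly at the servers of a set `A`. -/
def atServers {N M : ℕ} {R : Fin M → Finset (Fin N)} {K : Fin M → ℕ} {Ω α : Type}
    (sh : (j : Msg K) → {n // n ∈ R j.1} → Ω → α) (A : Finset (Fin N)) (ω : Ω) :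
    (n : {n // n ∈ A}) → MsgAt R K n.1 → α :=
  fun n => atServer sh n.1 ω

/-- A scheme for `X`-secure `T`-private linear computation with graph based replicated storage,
for the storage pattern `R` (the `m`-th message set may only be stored at the servers in `R m`),
`K m` messages in the `m`-th message set, and messages of `L` symbols from the finite field `F`.

All alphabets being finite, only the joint distribution of finitely many finitely valued random
variables matters, so that the sample space is taken finite. -/
structure Scheme {N M : ℕ} (R : Fin M → Finset (Fin N)) (X T : ℕ) (K : Fin M → ℕ)
    (F : Type) [Field F] [Fintype F] (L : ℕ) where
  /-- the sample space -/
  Ω : Type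
  [fintypeΩ : Fintype Ω]
  /-- the probability distribution on the sample space -/
  p : PMF Ω
  /-- the alphabet of the shares of the messages -/
  S : Type
  /-- the alphabet of the shares of the coefficients -/
  Q : Type
  /-- the messages -/
  W : Ω → Msg K → Fin L → F
  /-- the coefficients of the desired linear combination -/
  lam : Ω → Msg K → Fin L → F
  /-- the share of message `j = (m, k)` stored at server `n ∈ R m` -/
  share : (j : Msg K) → {n // n ∈ R j.1} → Ω → S
  /-- the share of the coefficients of message `j = (m, k)` sent to server `n ∈ R m` -/
  qshare : (j : Msg K) → {n // n ∈ R j.1} → Ω → Q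
  /-- the answer of server `n`, a string of symbols that is a function of its query and of its
  storage -/
  answer : (n : Fin N) → (MsgAt R K n → Q) → (MsgAt R K n → S) → List F
  /-- the symbols of the messages are i.i.d. uniform -/
  W_uniform : p.map W = PMF.uniformOfFintype (Msg K → Fin L → F)
  /-- the coefficients are i.i.d. uniform -/
  lam_uniform : p.map lam = PMF.uniformOfFintype (Msg K → Fin L → F)
  /-- every message is recoverable from the collection of its shares -/
  W_recoverable : ∀ j, condEntropy p (fun ω => W ω j) (fun ω n => share j n ω) = 0
  /-- the shares of the messages are independently generated -/
  share_indep : entropy p (fun ω j n => share j n ω) =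
    ∑ j, entropy p (fun ω n => share j n ω)
  /-- `X`-security -/
  secure : ∀ A : Finset (Fin N), A.card = X → mutualInfo p (atServers share A) W = 0
  /-- `T`-privacy -/
  isPrivate : ∀ A : Finset (Fin N), A.card = T → mutualInfo p (atServers qshare A) lam = 0
  /-- the coefficients of every message are recoverable from the collection of their shares -/
  lam_recoverable : ∀ j, condEntropy p (fun ω => lam ω j) (fun ω n => qshare j n ω) = 0
  /-- the shares of the coefficients are independently generated -/
  qshare_indep : entropy p (fun ω j n => qshare j n ω) =
    ∑ j, entropy p (fun ω n => qshare j n ω)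
  /-- the user has no prior knowledge of the storage -/
  storage_indep : mutualInfo p (atServers share Finset.univ)
    (fun ω => (lam ω, atServers qshare Finset.univ ω)) = 0
  /-- answers are self-delimiting: no string that a server may return for a given query is a
  proper prefix of another one, so that no information is carried by the end of a transmission
  on top of the transmitted symbols -/
  answer_prefix_free : ∀ (n : Fin N) (x : MsgAt R K n → Q) (s s' : MsgAt R K n → S),
    answer n x s <+: answer n x s' → answer n x s = answer n x s'
  /-- correctness: the desired linear combination is determined by the answers, the queries and
  the coefficients -/
  correct : condEntropy p (fun ω => linComb (lam ω) (W ω))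
    (fun ω => ((fun n => answer n (atServer qshare n ω) (atServer share n ω)),
      atServers qshare Finset.univ ω, lam ω)) = 0

attribute [instance] Scheme.fintypeΩ

variable {N M : ℕ} {R : Fin M → Finset (Fin N)} {X T : ℕ} {K : Fin M → ℕ}
  {F : Type} [Field F] [Fintype F] {L : ℕ}

/-- The expected total number of symbols downloaded from all servers. -/
def Scheme.download (s : Scheme R X T K F L) : ℝ≥0∞ :=
  ∑ ω, s.p ω *
    ∑ n, ((s.answer n (atServer s.qshare n ω) (atServer s.share n ω)).length : ℝ≥0∞)

/-- The rate: desired symbols retrieved per downloaded symbol. -/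
def Scheme.rate (s : Scheme R X T K F L) : ℝ≥0∞ := (L : ℝ≥0∞) / s.download

/-- The capacity, the supremum of the rates of all schemes.  A scheme may choose the finite field
and the message length `L ≥ 1`. -/
def capacity {N M : ℕ} (R : Fin M → Finset (Fin N)) (X T : ℕ) (K : Fin M → ℕ) : ℝ≥0∞ :=
  ⨆ (F : Type) (_ : Field F) (_ : Fintype F) (L : ℕ) (_ : 0 < L) (s : Scheme R X T K F L),
    s.rate

/-- The smallest replication factor, `min_m ρ_m` with `ρ_m = |R m|`. -/
def minReplication {N M : ℕ} (R : Fin M → Finset (Fin N)) : ℕ := ⨅ m, (R m).card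

/-- The feasible region of the linear program. -/
def feasibleRegion {N M : ℕ} (R : Fin M → Finset (Fin N)) (X T : ℕ) : Set (Fin N → ℝ) :=
  {D | (∀ n, 0 ≤ D n) ∧
    ∀ m, ∀ R' ⊆ R m, R'.card + X + T = (R m).card → 1 ≤ ∑ n ∈ R', D n}

end

end GXSTPLC

/-! Converse. Cover `R m` by sets `A`, `B`, `C` of servers with `|A| = X` and `|B| = T`. Give the
decoder for free what `A` stores of the `m`-th message set and all shares of the other messages. By
security and independent generation this side information is independent of the messages of set `m`
(`Scheme.messageSet_indep_sideInfo`). If the coefficients select one message `(m, k)`, the answers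
of `B` and `C` together with the side information determine it, so `L log q`, with `q = |F|`, is at
most the information that the answers of `B` leak about this message plus the entropy of the answers
of `C`. By privacy the expected leakage does not depend on the coefficients being conditioned on, so
the bounds for all `k` may be added under one and the same law of the queries of `B`. Since the
messages are independent, the leakages then add up to at most the entropy of the answers of `B`.
Kraft's inequality turns entropies into expected lengths, and the result is `L ≤ D(C) + D(B) / K m`
(`Scheme.converse_bound`). If some `|R m| ≤ X + T`, one may take `C = ∅` and the rate is at most `1
/ K m`; otherwise the normalized downloads become feasible for the linear program as `K → ∞`.

Achievability. Write a message as a sum of terms `a_S` over the `X`-subsets `S` of `R m`, with `a_S`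
withheld from the servers in `S`, and a coefficient vector likewise as a sum of `b_U` over the
`T`-subsets `U`. Each product `a_S * b_U` is known to every server of `R m \ (S ∪ U)`, and there are
at least `|R m| - X - T` of these. Let server `n` own `d n = ⌈L * D n⌉` vectors of `F^L`, all in
general position. Feasibility of `D` says that the servers of `R m \ (S ∪ U)` own at least `L`
vectors, so they can expand the product in them. Every server adds up its coordinates over all
messages and all pairs `(S, U)`; combining the received symbols with the vectors yields the sum of
all products, which is the desired combination (`sum_answerSymbol_mul`). The rate `L / ∑ d n` is
independent of `K` and tends to `1 / ∑ D n` as `L → ∞`. -/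

namespace GXSTPLC

/-! ### Entropy, independence and prefix-free codes on a finite probability space. -/

section Entropy

variable {Ω α β γ : Type} (p : PMF Ω)

/-- The probability of an outcome, as a real number. -/
noncomputable def weight (ω : Ω) : ℝ := (p ω).toReal

/-- On the support of `p`, the value of `Z` determines the value of `Y`. -/
def Determines (Z : Ω → α) (Y : Ω → β) : Prop :=
  ∀ ω ω', 0 < weight p ω → 0 < weight p ω' → Z ω = Z ω' → Y ω = Y ω'

lemma weight_nonneg (ω : Ω) : 0 ≤ weight p ω := ENNReal.toReal_nonneg

lemma weight_eq_zero_or_pos (ω : Ω) : weight p ω = 0 ∨ 0 < weight p ω :=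
  (weight_nonneg p ω).eq_or_lt'

variable {p} in
lemma determines_of_comp {Z : Ω → α} {Y : Ω → β} (f : α → β) (h : ∀ ω, Y ω = f (Z ω)) :
    Determines p Z Y := fun ω ω' _ _ hz => by rw [h, h, hz]

variable [Fintype Ω]

open Classical in
/-- The probability of the event `Z = x`, as a real number. -/
noncomputable def prob (Z : Ω → α) (x : α) : ℝ := ∑ ω, if Z ω = x then weight p ω else 0

lemma sum_weight : ∑ ω, weight p ω = 1 := by
  have h := p.tsum_coe
  rw [tsum_fintype] at h
  rw [show (1 : ℝ) = (1 : ℝ≥0∞).toReal by simp, ← h,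
    ENNReal.toReal_sum fun ω _ => p.apply_ne_top ω]
  rfl

lemma map_apply_toReal (Z : Ω → α) (x : α) : (p.map Z x).toReal = prob p Z x := by
  classical
  rw [PMF.map_apply, tsum_fintype, ENNReal.toReal_sum]
  · refine Finset.sum_congr rfl fun ω _ => ?_
    by_cases h : Z ω = x
    · simp [h, weight]
    · simp [h, Ne.symm h]
  · intro ω _
    split_ifs
    · exact p.apply_ne_top ω
    · simp

lemma prob_nonneg (Z : Ω → α) (x : α) : 0 ≤ prob p Z x :=
  Finset.sum_nonneg fun ω _ => by split_ifs; exacts [weight_nonneg p ω, le_rfl]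

lemma weight_le_prob (Z : Ω → α) (ω : Ω) : weight p ω ≤ prob p Z (Z ω) := by
  classical
  have := Finset.single_le_sum (f := fun ω' => if Z ω' = Z ω then weight p ω' else 0)
    (fun ω' _ => by split_ifs; exacts [weight_nonneg p ω', le_rfl]) (Finset.mem_univ ω)
  simpa [prob] using this

lemma prob_pos {Z : Ω → α} {ω : Ω} (h : 0 < weight p ω) : 0 < prob p Z (Z ω) :=
  h.trans_le (weight_le_prob p Z ω)

lemma exists_of_prob_pos {Z : Ω → α} {x : α} (h : 0 < prob p Z x) :
    ∃ ω, 0 < weight p ω ∧ Z ω = x := by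
  classical
  by_contra! hc
  refine h.ne' (Finset.sum_eq_zero fun ω _ => ?_)
  by_cases hx : Z ω = x
  · rcases weight_eq_zero_or_pos p ω with h0 | h0
    · simp [h0]
    · exact absurd hx (hc ω h0)
  · simp [hx]

/-- Regrouping an expectation by the values of `Z`. -/
lemma sum_weight_mul_comp [DecidableEq α] (Z : Ω → α) (f : α → ℝ) :
    ∑ ω, weight p ω * f (Z ω) = ∑ x ∈ Finset.univ.image Z, prob p Z x * f x := by
  classical
  simp_rw [prob, Finset.sum_mul]
  rw [Finset.sum_comm]
  refine Finset.sum_congr rfl fun ω _ => ?_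
  rw [Finset.sum_eq_single (Z ω)]
  · simp
  · intro x _ hx
    simp [Ne.symm hx]
  · intro h
    exact absurd (Finset.mem_image_of_mem Z (Finset.mem_univ ω)) h

lemma prob_eq_zero_of_notMem [DecidableEq α] {Z : Ω → α} {x : α}
    (hx : x ∉ Finset.univ.image Z) : prob p Z x = 0 := by
  classical
  refine Finset.sum_eq_zero fun ω _ => if_neg fun h => hx ?_
  exact h ▸ Finset.mem_image_of_mem Z (Finset.mem_univ ω)

lemma sum_prob [DecidableEq α] (Z : Ω → α) : ∑ x ∈ Finset.univ.image Z, prob p Z x = 1 := by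
  have := sum_weight_mul_comp p Z fun _ => 1
  simpa [sum_weight] using this.symm

/-- Entropy as an expectation. -/
lemma entropy_eq_sum (Z : Ω → α) :
    entropy p Z = ∑ ω, weight p ω * -Real.log (prob p Z (Z ω)) := by
  classical
  rw [sum_weight_mul_comp p Z fun x => -Real.log (prob p Z x), entropy,
    tsum_eq_sum (s := Finset.univ.image Z)]
  · refine Finset.sum_congr rfl fun x _ => ?_
    rw [map_apply_toReal, Real.negMulLog]
    ring
  · intro x hx
    rw [map_apply_toReal, prob_eq_zero_of_notMem p hx]
    simp

lemma sum_weight_mul_le {f g : Ω → ℝ} (h : ∀ ω, 0 < weight p ω → f ω ≤ g ω) :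
    ∑ ω, weight p ω * f ω ≤ ∑ ω, weight p ω * g ω := by
  refine Finset.sum_le_sum fun ω _ => ?_
  rcases weight_eq_zero_or_pos p ω with h0 | h0
  · simp [h0]
  · exact mul_le_mul_of_nonneg_left (h ω h0) h0.le

lemma eq_of_sum_weight_mul_eq {f g : Ω → ℝ} (h : ∀ ω, 0 < weight p ω → f ω ≤ g ω)
    (he : ∑ ω, weight p ω * f ω = ∑ ω, weight p ω * g ω) (ω : Ω) (hω : 0 < weight p ω) :
    f ω = g ω := by
  have h' : ∀ ω ∈ Finset.univ, weight p ω * f ω ≤ weight p ω * g ω := fun ω _ => by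
    rcases weight_eq_zero_or_pos p ω with h0 | h0
    · simp [h0]
    · exact mul_le_mul_of_nonneg_left (h ω h0) h0.le
  exact mul_left_cancel₀ hω.ne' ((Finset.sum_eq_sum_iff_of_le h').1 he ω (Finset.mem_univ ω))

variable {p}

lemma Determines.prob_le {Z : Ω → α} {Y : Ω → β} (h : Determines p Z Y) {ω : Ω}
    (hω : 0 < weight p ω) : prob p Z (Z ω) ≤ prob p Y (Y ω) := by
  classical
  refine Finset.sum_le_sum fun ω' _ => ?_
  rcases weight_eq_zero_or_pos p ω' with h0 | h0
  · simp [h0]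
  · by_cases hz : Z ω' = Z ω
    · simp [hz, h ω' ω h0 hω hz]
    · rw [if_neg hz]
      split_ifs
      exacts [h0.le, le_rfl]

lemma Determines.entropy_le {Z : Ω → α} {Y : Ω → β} (h : Determines p Z Y) :
    entropy p Y ≤ entropy p Z := by
  rw [entropy_eq_sum, entropy_eq_sum]
  exact sum_weight_mul_le p fun ω hω =>
    neg_le_neg (Real.log_le_log (prob_pos p hω) (h.prob_le hω))

lemma entropy_congr {Z : Ω → α} {Y : Ω → β} (h : Determines p Z Y) (h' : Determines p Y Z) :
    entropy p Y = entropy p Z := le_antisymm h.entropy_le h'.entropy_le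

lemma Determines.condEntropy_eq_zero {Z : Ω → α} {Y : Ω → β} (h : Determines p Z Y) :
    condEntropy p Y Z = 0 :=
  sub_eq_zero.2 <| entropy_congr (fun ω ω' hω hω' hz => Prod.ext (h ω ω' hω hω' hz) hz)
    (determines_of_comp Prod.snd fun _ => rfl)

/-- Entropies are expectations of `-log prob`, and the two integrands are comparable pointwise, so
equal expectations force equal probabilities on the support. The fibre of `(Y, Z)` then has the same
mass as the fibre of `Z` containing it, and no mass is left for a second value of `Y`. -/
lemma determines_of_condEntropy_eq_zero {Z : Ω → α} {Y : Ω → β}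
    (h : condEntropy p Y Z = 0) : Determines p Z Y := by
  classical
  have hd : Determines p (fun ω => (Y ω, Z ω)) Z := determines_of_comp Prod.snd fun _ => rfl
  have h' : entropy p Z = entropy p fun ω => (Y ω, Z ω) := (sub_eq_zero.1 h).symm
  rw [entropy_eq_sum, entropy_eq_sum] at h'
  have key := eq_of_sum_weight_mul_eq p (fun ω hω =>
    neg_le_neg (Real.log_le_log (prob_pos p hω) (hd.prob_le hω))) h'
  intro ω ω' hω hω' hz
  have hp : prob p (fun ω => (Y ω, Z ω)) (Y ω, Z ω) = prob p Z (Z ω) :=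
    Real.log_injOn_pos (prob_pos p (Z := fun ω => (Y ω, Z ω)) hω) (prob_pos p hω)
      (neg_injective (key ω hω)).symm
  have hle : ∀ ω'' ∈ Finset.univ, (if (Y ω'', Z ω'') = (Y ω, Z ω) then weight p ω'' else 0) ≤
      if Z ω'' = Z ω then weight p ω'' else 0 := fun ω'' _ => by
    by_cases h1 : Z ω'' = Z ω
    · rw [if_pos h1]
      split_ifs
      exacts [le_rfl, weight_nonneg p _]
    · simp [h1]
  have := (Finset.sum_eq_sum_iff_of_le hle).1 (by unfold prob at hp; convert hp) ω'
    (Finset.mem_univ ω')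
  rw [if_pos hz.symm] at this
  by_contra hne
  rw [if_neg fun he => hne (Prod.ext_iff.1 he).1.symm] at this
  exact hω'.ne this

variable (p)

/-- Gibbs' inequality, with the equality case. -/
lemma sum_weight_mul_log_le [DecidableEq α] (Z : Ω → α) (g : α → ℝ)
    (hg : ∀ ω, 0 < weight p ω → 0 < g (Z ω)) (hg0 : ∀ x, 0 ≤ g x)
    (hs : ∑ x ∈ Finset.univ.image Z, g x ≤ 1) :
    entropy p Z ≤ ∑ ω, weight p ω * -Real.log (g (Z ω)) ∧
    (entropy p Z = ∑ ω, weight p ω * -Real.log (g (Z ω)) →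
      ∀ ω, 0 < weight p ω → prob p Z (Z ω) = g (Z ω)) := by
  -- The expectation of `g / prob - 1` is at most `∑ g - 1 ≤ 0`; the claim follows from `log t ≤ t -
  -- 1`, which is strict for `t ≠ 1`.
  have hratio : ∑ ω, weight p ω * (g (Z ω) / prob p Z (Z ω) - 1) ≤ 0 := by
    rw [sum_weight_mul_comp p Z fun x => g x / prob p Z x - 1]
    calc _ ≤ ∑ x ∈ Finset.univ.image Z, (g x - prob p Z x) := by
          refine Finset.sum_le_sum fun x _ => ?_
          rcases (prob_nonneg p Z x).eq_or_lt' with h0 | h0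
          · simp [h0, hg0 x]
          · exact le_of_eq (by field_simp)
      _ ≤ 0 := by
          rw [Finset.sum_sub_distrib, sum_prob]
          linarith
  have hlog : ∀ ω, 0 < weight p ω → -Real.log (prob p Z (Z ω)) + Real.log (g (Z ω)) ≤
      g (Z ω) / prob p Z (Z ω) - 1 := fun ω hω => by
    have := Real.log_le_sub_one_of_pos (div_pos (hg ω hω) (prob_pos p (Z := Z) hω))
    rw [Real.log_div (hg ω hω).ne' (prob_pos p hω).ne'] at this
    linarith
  have hsum := sum_weight_mul_le p hlog
  have hdiff : ∑ ω, weight p ω * (-Real.log (prob p Z (Z ω)) + Real.log (g (Z ω))) =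
      entropy p Z - ∑ ω, weight p ω * -Real.log (g (Z ω)) := by
    rw [entropy_eq_sum, ← Finset.sum_sub_distrib]
    exact Finset.sum_congr rfl fun ω _ => by ring
  refine ⟨by linarith, fun he ω hω => ?_⟩
  have heq := eq_of_sum_weight_mul_eq p hlog (by linarith) ω hω
  by_contra hne
  have := Real.log_lt_sub_one_of_pos (div_pos (hg ω hω) (prob_pos p (Z := Z) hω))
    (fun h => hne ((div_eq_one_iff_eq (prob_pos p hω).ne').1 h).symm)
  rw [Real.log_div (hg ω hω).ne' (prob_pos p hω).ne'] at this
  linarith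

/-- Marginalization. -/
lemma sum_prob_pair_le (Y : Ω → α) (Z : Ω → β) (s : Finset α) (z : β) :
    ∑ y ∈ s, prob p (fun ω => (Y ω, Z ω)) (y, z) ≤ prob p Z z := by
  classical
  unfold prob
  rw [Finset.sum_comm]
  refine Finset.sum_le_sum fun ω _ => ?_
  by_cases hz : Z ω = z
  · simp only [hz, Prod.mk.injEq, and_true, if_true]
    rw [Finset.sum_ite_eq]
    split_ifs
    exacts [le_rfl, weight_nonneg p ω]
  · simp [hz]

/-- Submodularity of entropy: conditioning reduces mutual information to a nonnegative
quantity. -/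
lemma entropy_submodular (Y : Ω → α) (Z : Ω → β) (A : Ω → γ) :
    entropy p (fun ω => (Y ω, Z ω, A ω)) + entropy p A ≤
      entropy p (fun ω => (Y ω, A ω)) + entropy p (fun ω => (Z ω, A ω)) := by
  classical
  set V := fun ω => (Y ω, Z ω, A ω)
  -- The law under which `Y` and `Z` are conditionally independent given `A`, with the same pair
  -- marginals; Gibbs' inequality is applied to it. Where `A` has probability zero, `g` is zero by
  -- the convention for division.
  set g : α × β × γ → ℝ := fun x => prob p (fun ω => (Y ω, A ω)) (x.1, x.2.2) *
    prob p (fun ω => (Z ω, A ω)) x.2 / prob p A x.2.2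
  have hg0 : ∀ x, 0 ≤ g x := fun x =>
    div_nonneg (mul_nonneg (prob_nonneg _ _ _) (prob_nonneg _ _ _)) (prob_nonneg _ _ _)
  have h1 : ∀ ω, 0 < weight p ω → 0 < prob p (fun ω => (Y ω, A ω)) (Y ω, A ω) := fun ω hω =>
    prob_pos p (Z := fun ω => (Y ω, A ω)) hω
  have h2 : ∀ ω, 0 < weight p ω → 0 < prob p (fun ω => (Z ω, A ω)) (Z ω, A ω) := fun ω hω =>
    prob_pos p (Z := fun ω => (Z ω, A ω)) hω
  have h3 : ∀ ω, 0 < weight p ω → 0 < prob p A (A ω) := fun ω hω => prob_pos p hω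
  have hs : ∑ x ∈ Finset.univ.image V, g x ≤ 1 := by
    calc ∑ x ∈ Finset.univ.image V, g x
        ≤ ∑ x ∈ Finset.univ.image Y ×ˢ Finset.univ.image Z ×ˢ Finset.univ.image A, g x := by
          refine Finset.sum_le_sum_of_subset_of_nonneg ?_ fun x _ _ => hg0 x
          intro x hx
          obtain ⟨ω, -, rfl⟩ := Finset.mem_image.1 hx
          simp [V]
      _ ≤ ∑ a ∈ Finset.univ.image A, prob p A a := by
          rw [Finset.sum_product, Finset.sum_comm, Finset.sum_product, Finset.sum_comm]
          refine Finset.sum_le_sum fun a _ => ?_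
          calc ∑ z ∈ Finset.univ.image Z, ∑ y ∈ Finset.univ.image Y, g (y, z, a)
              = (∑ z ∈ Finset.univ.image Z, prob p (fun ω => (Z ω, A ω)) (z, a)) *
                (∑ y ∈ Finset.univ.image Y, prob p (fun ω => (Y ω, A ω)) (y, a)) /
                  prob p A a := by
                rw [Finset.sum_mul_sum, Finset.sum_div]
                refine Finset.sum_congr rfl fun z _ => ?_
                rw [Finset.sum_div]
                exact Finset.sum_congr rfl fun y _ => by simp only [g]; ring
            _ ≤ prob p A a * prob p A a / prob p A a := by
                refine div_le_div_of_nonneg_right (mul_le_mul (sum_prob_pair_le _ _ _ _ _)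
                  (sum_prob_pair_le _ _ _ _ _) (Finset.sum_nonneg fun y _ => prob_nonneg _ _ _)
                  (prob_nonneg _ _ _)) (prob_nonneg _ _ _)
            _ ≤ prob p A a := by
                rcases (prob_nonneg p A a).eq_or_lt' with h0 | h0
                · simp [h0]
                · exact le_of_eq (by field_simp)
      _ = 1 := sum_prob p A
  have := (sum_weight_mul_log_le p V g
    (fun ω hω => div_pos (mul_pos (h1 ω hω) (h2 ω hω)) (h3 ω hω)) hg0 hs).1
  have hexp : ∑ ω, weight p ω * -Real.log (g (V ω)) =
      entropy p (fun ω => (Y ω, A ω)) + entropy p (fun ω => (Z ω, A ω)) - entropy p A := by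
    rw [entropy_eq_sum, entropy_eq_sum, entropy_eq_sum, ← Finset.sum_add_distrib,
      ← Finset.sum_sub_distrib]
    refine Finset.sum_congr rfl fun ω _ => ?_
    rcases weight_eq_zero_or_pos p ω with h0 | h0
    · simp [h0]
    · simp only [g, V]
      rw [Real.log_div (mul_pos (h1 ω h0) (h2 ω h0)).ne' (h3 ω h0).ne',
        Real.log_mul (h1 ω h0).ne' (h2 ω h0).ne']
      ring
  linarith

lemma entropy_const (x : α) : entropy p (fun _ : Ω => x) = 0 := by
  rw [entropy_eq_sum]
  simp [prob, sum_weight]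

lemma entropy_pair_le (Y : Ω → α) (Z : Ω → β) :
    entropy p (fun ω => (Y ω, Z ω)) ≤ entropy p Y + entropy p Z := by
  have h := entropy_submodular p Y Z fun _ => ()
  rw [entropy_const] at h
  have e1 : entropy p (fun ω => (Y ω, Z ω, ())) = entropy p fun ω => (Y ω, Z ω) :=
    entropy_congr (determines_of_comp (fun x => (x.1, x.2, ())) fun _ => rfl)
      (determines_of_comp (fun x => (x.1, x.2.1)) fun _ => rfl)
  have e2 : entropy p (fun ω => (Y ω, ())) = entropy p Y :=
    entropy_congr (determines_of_comp (fun x => (x, ())) fun _ => rfl)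
      (determines_of_comp Prod.fst fun _ => rfl)
  have e3 : entropy p (fun ω => (Z ω, ())) = entropy p Z :=
    entropy_congr (determines_of_comp (fun x => (x, ())) fun _ => rfl)
      (determines_of_comp Prod.fst fun _ => rfl)
  linarith

/-- Subadditivity of conditional entropy over a finite family. -/
lemma entropy_finset_pair_le {ι : Type} [DecidableEq ι] {α : ι → Type} (s : Finset ι)
    (Z : (i : ι) → Ω → α i) (B : Ω → β) :
    entropy p (fun ω => ((fun i : {i // i ∈ s} => Z i ω), B ω)) ≤
      entropy p B + ∑ i ∈ s, (entropy p (fun ω => (Z i ω, B ω)) - entropy p B) := by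
  induction s using Finset.induction_on with
  | empty =>
    rw [Finset.sum_empty, add_zero]
    refine Determines.entropy_le fun ω ω' _ _ h => Prod.ext ?_ h
    funext i
    exact absurd i.2 (Finset.notMem_empty _)
  | insert a s ha ih =>
    rw [Finset.sum_insert ha]
    have h := entropy_submodular p (Z a) (fun ω => fun i : {i // i ∈ s} => Z i ω) B
    have h' : entropy p (fun ω => ((fun i : {i // i ∈ insert a s} => Z i ω), B ω)) ≤
        entropy p (fun ω => (Z a ω, (fun i : {i // i ∈ s} => Z i ω), B ω)) := by
      refine Determines.entropy_le fun ω ω' _ _ h => ?_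
      simp only [Prod.mk.injEq] at h
      refine Prod.ext (funext fun i => ?_) h.2.2
      obtain ⟨i, hi⟩ := i
      rcases Finset.mem_insert.1 hi with rfl | hi
      · exact h.1
      · exact congrFun h.2.1 ⟨i, hi⟩
    linarith

lemma entropy_finset_le {ι : Type} [DecidableEq ι] {α : ι → Type} (s : Finset ι)
    (Z : (i : ι) → Ω → α i) :
    entropy p (fun ω => fun i : {i // i ∈ s} => Z i ω) ≤ ∑ i ∈ s, entropy p (Z i) := by
  have h := entropy_finset_pair_le p s Z fun _ => ()
  rw [entropy_const, zero_add] at h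
  have e : ∀ {δ : Type} (Y : Ω → δ), entropy p (fun ω => (Y ω, ())) = entropy p Y := fun Y =>
    entropy_congr (determines_of_comp (fun x => (x, ())) fun _ => rfl)
      (determines_of_comp Prod.fst fun _ => rfl)
  rw [e] at h
  simpa [e] using h

/-- Zero mutual information means independence. -/
lemma prob_pair_of_mutualInfo_eq_zero {Y : Ω → α} {Z : Ω → β} (h : mutualInfo p Y Z = 0)
    (y : α) (z : β) : prob p (fun ω => (Y ω, Z ω)) (y, z) = prob p Y y * prob p Z z := by
  classical
  set V := fun ω => (Y ω, Z ω)
  set g : α × β → ℝ := fun x => prob p Y x.1 * prob p Z x.2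
  have hg0 : ∀ x, 0 ≤ g x := fun x => mul_nonneg (prob_nonneg _ _ _) (prob_nonneg _ _ _)
  have hsub : Finset.univ.image V ⊆ Finset.univ.image Y ×ˢ Finset.univ.image Z := by
    intro x hx
    obtain ⟨ω, -, rfl⟩ := Finset.mem_image.1 hx
    simp [V]
  have htot : ∑ x ∈ Finset.univ.image Y ×ˢ Finset.univ.image Z, g x = 1 := by
    rw [Finset.sum_product, ← Finset.sum_mul_sum, sum_prob, sum_prob, one_mul]
  have hs : ∑ x ∈ Finset.univ.image V, g x ≤ 1 :=
    (Finset.sum_le_sum_of_subset_of_nonneg hsub fun x _ _ => hg0 x).trans htot.le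
  have hexp : entropy p V = ∑ ω, weight p ω * -Real.log (g (V ω)) := by
    rw [mutualInfo, sub_eq_zero] at h
    rw [← h, entropy_eq_sum, entropy_eq_sum, ← Finset.sum_add_distrib]
    refine Finset.sum_congr rfl fun ω _ => ?_
    rcases weight_eq_zero_or_pos p ω with h0 | h0
    · simp [h0]
    · rw [Real.log_mul (prob_pos p h0).ne' (prob_pos p h0).ne']
      ring
  have key := (sum_weight_mul_log_le p V g
    (fun ω hω => mul_pos (prob_pos p hω) (prob_pos p hω)) hg0 hs).2 hexp
  -- The equality case of Gibbs only speaks about the support of `V`. Off it, `prob p V` vanishes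
  -- and is below `g`; both functions have total mass 1 on the product, so they agree there.
  have hle : ∀ x ∈ Finset.univ.image Y ×ˢ Finset.univ.image Z, prob p V x ≤ g x := by
    intro x _
    rcases (prob_nonneg p V x).eq_or_lt' with h0 | h0
    · exact h0 ▸ hg0 x
    · obtain ⟨ω, hω, rfl⟩ := exists_of_prob_pos p h0
      exact (key ω hω).le
  have htot' : ∑ x ∈ Finset.univ.image Y ×ˢ Finset.univ.image Z, prob p V x = 1 := by
    rw [← sum_prob p V]
    exact (Finset.sum_subset hsub fun x _ hx => prob_eq_zero_of_notMem p hx).symm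
  by_cases hx : (y, z) ∈ Finset.univ.image Y ×ˢ Finset.univ.image Z
  · exact (Finset.sum_eq_sum_iff_of_le hle).1 (htot'.trans htot.symm) (y, z) hx
  · rw [prob_eq_zero_of_notMem p fun h => hx (hsub h)]
    rw [Finset.mem_product, not_and_or] at hx
    rcases hx with hx | hx
    · rw [prob_eq_zero_of_notMem p hx, zero_mul]
    · rw [prob_eq_zero_of_notMem p hx, mul_zero]

/-- Kraft's inequality for a prefix-free set of strings. -/
lemma kraft_of_prefix_free {F : Type} [Fintype F] [Nonempty F] (s : Finset (List F))
    (hs : ∀ a ∈ s, ∀ b ∈ s, a <+: b → a = b) :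
    ∑ a ∈ s, (1 / Fintype.card F : ℝ) ^ a.length ≤ 1 := by
  -- The empty string destroys unique decodability, which Kraft–McMillan requires; but it is a
  -- prefix of every string, so it is then the only codeword.
  by_cases hnil : [] ∈ s
  · have : s = {[]} := Finset.eq_singleton_iff_unique_mem.2
      ⟨hnil, fun b hb => (hs _ hnil b hb List.nil_prefix).symm⟩
    simp [this]
  · refine InformationTheory.kraft_mcmillan_inequality fun l₁ => ?_
    induction l₁ with
    | nil =>
      intro l₂ _ h₂ h
      cases l₂ with
      | nil => rfl
      | cons b l₂ =>
        have : b = [] := by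
          have := h.symm
          simp at this
          exact this.1
        exact absurd (by simpa [this] using h₂ b (by simp)) hnil
    | cons a l₁ ih =>
      intro l₂ h₁ h₂ h
      cases l₂ with
      | nil =>
        have : a = [] := by
          simp at h
          exact h.1
        exact absurd (by simpa [this] using h₁ a (by simp)) hnil
      | cons b l₂ =>
        have ha : a ∈ s := by simpa using h₁ a (by simp)
        have hb : b ∈ s := by simpa using h₂ b (by simp)
        rw [List.flatten_cons, List.flatten_cons] at h
        have hab : a = b := by
          rcases List.prefix_or_prefix_of_prefix (l₃ := a ++ l₁.flatten)
            (List.prefix_append _ _) (h ▸ List.prefix_append b l₂.flatten) with h' | h'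
          · exact hs a ha b hb h'
          · exact (hs b hb a ha h').symm
        subst hab
        rw [ih l₂ (fun w hw => h₁ w (by simp [hw])) (fun w hw => h₂ w (by simp [hw]))
          (List.append_cancel_left h)]

/-- The entropy of a prefix-free random string is at most its expected length. -/
lemma entropy_le_expected_length {F : Type} [Fintype F] [Nonempty F] (Z : Ω → List F)
    (hZ : ∀ ω ω', Z ω <+: Z ω' → Z ω = Z ω') :
    entropy p Z ≤ Real.log (Fintype.card F) * ∑ ω, weight p ω * (Z ω).length := by
  classical
  have hc : (0 : ℝ) < Fintype.card F := by exact_mod_cast Fintype.card_pos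
  have h := (sum_weight_mul_log_le p Z (fun a => (1 / Fintype.card F : ℝ) ^ a.length)
    (fun ω _ => by positivity) (fun a => by positivity) (kraft_of_prefix_free _ fun a ha b hb => by
      obtain ⟨ω, -, rfl⟩ := Finset.mem_image.1 ha
      obtain ⟨ω', -, rfl⟩ := Finset.mem_image.1 hb
      exact hZ ω ω')).1
  refine h.trans (le_of_eq ?_)
  rw [Finset.mul_sum]
  refine Finset.sum_congr rfl fun ω _ => ?_
  rw [Real.log_pow, one_div, Real.log_inv]
  ring

/-- The entropy is at most the logarithm of the size of the alphabet. -/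
lemma entropy_le_log_card [Fintype α] [Nonempty α] (Z : Ω → α) :
    entropy p Z ≤ Real.log (Fintype.card α) := by
  classical
  have hc : (0 : ℝ) < Fintype.card α := by exact_mod_cast Fintype.card_pos
  have h := (sum_weight_mul_log_le p Z (fun _ => (Fintype.card α : ℝ)⁻¹)
    (fun _ _ => by positivity) (fun _ => by positivity) (by
      rw [Finset.sum_const, nsmul_eq_mul, ← div_eq_mul_inv, div_le_one hc]
      exact_mod_cast Finset.card_le_univ _)).1
  rwa [Real.log_inv, neg_neg, ← Finset.sum_mul, sum_weight, one_mul] at h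

lemma entropy_of_map_uniform [Fintype α] [Nonempty α] {Z : Ω → α}
    (h : p.map Z = PMF.uniformOfFintype α) : entropy p Z = Real.log (Fintype.card α) := by
  have hp : ∀ x, prob p Z x = (Fintype.card α : ℝ)⁻¹ := fun x => by
    rw [← map_apply_toReal, h, PMF.uniformOfFintype_apply]
    simp
  rw [entropy_eq_sum]
  simp_rw [hp, Real.log_inv, neg_neg, ← Finset.sum_mul, sum_weight, one_mul]

/-- Functions of independent random variables are independent. -/
lemma mutualInfo_eq_zero_of_determines_left {α' : Type} {Y : Ω → α} {Z : Ω → β} {Y' : Ω → α'}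
    (h : mutualInfo p Y Z = 0) (hY : Determines p Y Y') : mutualInfo p Y' Z = 0 := by
  have h1 := entropy_submodular p Y Z Y'
  have h2 : entropy p (fun ω => (Y ω, Z ω, Y' ω)) = entropy p fun ω => (Y ω, Z ω) :=
    entropy_congr (fun ω ω' hω hω' he => by
      simp only [Prod.mk.injEq] at he ⊢
      exact ⟨he.1, he.2, hY ω ω' hω hω' he.1⟩)
      (determines_of_comp (fun x => (x.1, x.2.1)) fun _ => rfl)
  have h3 : entropy p (fun ω => (Y ω, Y' ω)) = entropy p Y :=
    entropy_congr (fun ω ω' hω hω' he => Prod.ext he (hY ω ω' hω hω' he))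
      (determines_of_comp Prod.fst fun _ => rfl)
  have h4 : entropy p (fun ω => (Z ω, Y' ω)) = entropy p fun ω => (Y' ω, Z ω) :=
    entropy_congr (determines_of_comp Prod.swap fun _ => rfl)
      (determines_of_comp Prod.swap fun _ => rfl)
  have h5 := entropy_pair_le p Y' Z
  unfold mutualInfo at *
  linarith

lemma mutualInfo_comm (Y : Ω → α) (Z : Ω → β) : mutualInfo p Y Z = mutualInfo p Z Y := by
  have : entropy p (fun ω => (Z ω, Y ω)) = entropy p fun ω => (Y ω, Z ω) :=
    entropy_congr (determines_of_comp Prod.swap fun _ => rfl)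
      (determines_of_comp Prod.swap fun _ => rfl)
  unfold mutualInfo
  linarith

lemma mutualInfo_eq_zero_of_determines_right {β' : Type} {Y : Ω → α} {Z : Ω → β} {Z' : Ω → β'}
    (h : mutualInfo p Y Z = 0) (hZ : Determines p Z Z') : mutualInfo p Y Z' = 0 := by
  rw [mutualInfo_comm] at h ⊢
  exact mutualInfo_eq_zero_of_determines_left p h hZ

/-- Fubini for independent random variables. -/
lemma sum_weight_mul_of_mutualInfo_eq_zero {Y : Ω → α} {Z : Ω → β} (h : mutualInfo p Y Z = 0)
    (f : α → β → ℝ) : ∑ ω, weight p ω * f (Y ω) (Z ω) =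
      ∑ ω, weight p ω * ∑ ω', weight p ω' * f (Y ω) (Z ω') := by
  classical
  rw [sum_weight_mul_comp p (fun ω => (Y ω, Z ω)) fun x => f x.1 x.2,
    sum_weight_mul_comp p Y fun y => ∑ ω', weight p ω' * f y (Z ω')]
  have hsub : Finset.univ.image (fun ω => (Y ω, Z ω)) ⊆
      Finset.univ.image Y ×ˢ Finset.univ.image Z := by
    intro x hx
    obtain ⟨ω, -, rfl⟩ := Finset.mem_image.1 hx
    simp
  rw [Finset.sum_subset hsub fun x _ hx => by rw [prob_eq_zero_of_notMem p hx, zero_mul],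
    Finset.sum_product]
  refine Finset.sum_congr rfl fun y _ => ?_
  rw [sum_weight_mul_comp p Z fun z => f y z, Finset.mul_sum]
  refine Finset.sum_congr rfl fun z _ => ?_
  rw [prob_pair_of_mutualInfo_eq_zero p h]
  ring

/-- Conditioning on an independent event does not change an expectation. -/
lemma sum_ite_weight_mul_of_mutualInfo_eq_zero {Y : Ω → α} {Z : Ω → β}
    (h : mutualInfo p Y Z = 0) (f : α → ℝ) (z : β) [DecidablePred fun ω => Z ω = z] :
    ∑ ω, (if Z ω = z then weight p ω * f (Y ω) else 0) =
      prob p Z z * ∑ ω, weight p ω * f (Y ω) := by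
  classical
  -- Fubini for `f` times the indicator of `Z = z`.
  have := sum_weight_mul_of_mutualInfo_eq_zero p h fun y z' => if z' = z then f y else 0
  refine (Finset.sum_congr rfl fun ω _ => ?_).trans (this.trans ?_)
  · by_cases hz : Z ω = z <;> simp [hz]
  rw [Finset.mul_sum]
  refine Finset.sum_congr rfl fun ω _ => ?_
  rw [prob, Finset.mul_sum, Finset.sum_mul]
  refine Finset.sum_congr rfl fun ω' _ => ?_
  by_cases hz : Z ω' = z <;> simp [hz]
  ring

/-- A string that reveals something about each of several independent messages has a large
entropy. -/
lemma sum_condMutualInfo_le {ι : Type} [Fintype ι] (W : ι → Ω → α) (A : Ω → β) (B : Ω → γ)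
    (hW : entropy p (fun ω i => W i ω) = ∑ i, entropy p (W i))
    (hB : mutualInfo p (fun ω i => W i ω) B = 0) :
    ∑ i, (entropy p (fun ω => (W i ω, B ω)) + entropy p (fun ω => (A ω, B ω)) -
      entropy p (fun ω => (W i ω, A ω, B ω)) - entropy p B) ≤ entropy p A := by
  classical
  -- By independence `∑ H(W i | B) = H(W | B)`, while `∑ H(W i | A, B) ≥ H(W | A, B)`. So the sum is
  -- at most `I(W; A | B)`, hence at most `H(A)`.
  have h1 := entropy_finset_pair_le p Finset.univ W fun ω => (A ω, B ω)
  have h2 : entropy p (fun ω => ((fun i => W i ω), B ω)) ≤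
      entropy p (fun ω => ((fun i : {i // i ∈ Finset.univ} => W i ω), A ω, B ω)) :=
    Determines.entropy_le
      (determines_of_comp (fun x => (fun i => x.1 ⟨i, Finset.mem_univ i⟩, x.2.2)) fun _ => rfl)
  have h3 : ∀ i, entropy p (fun ω => (W i ω, B ω)) = entropy p (W i) + entropy p B := fun i => by
    have := mutualInfo_eq_zero_of_determines_left p hB
      (determines_of_comp (Y := W i) (fun x => x i) fun _ => rfl)
    unfold mutualInfo at this
    linarith
  have h4 := entropy_pair_le p A B
  have h5 : ∑ i, (entropy p (fun ω => (W i ω, B ω)) + entropy p (fun ω => (A ω, B ω)) -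
      entropy p (fun ω => (W i ω, A ω, B ω)) - entropy p B) =
      ∑ i, entropy p (W i) -
        ∑ i, (entropy p (fun ω => (W i ω, A ω, B ω)) - entropy p (fun ω => (A ω, B ω))) := by
    rw [← Finset.sum_sub_distrib]
    exact Finset.sum_congr rfl fun i _ => by rw [h3]; ring
  unfold mutualInfo at hB
  linarith

end Entropy

/-! ### The converse bound. -/

section Converse

variable {N M : ℕ} {R : Fin M → Finset (Fin N)} {X T : ℕ} {K : Fin M → ℕ}
  {F : Type} [Field F] {L : ℕ}

/-- The coefficient vectors that select message `j`. -/
def selector [DecidableEq (Msg K)] (F : Type) [Field F] (L : ℕ) (j : Msg K) :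
    Msg K → Fin L → F :=
  fun i _ => if i = j then 1 else 0

lemma linComb_selector [DecidableEq (Msg K)] (j : Msg K) (W : Msg K → Fin L → F) :
    linComb (selector F L j) W = W j := by
  funext ℓ
  simp [linComb, selector]

variable [Fintype F]

/-- What the servers of `A` store of the message sets `m` with `P m`. -/
def Scheme.partialStorage (s : Scheme R X T K F L) (P : Fin M → Prop) (A : Finset (Fin N))
    (ω : s.Ω) : (n : {n // n ∈ A}) → {j : MsgAt R K n.1 // P j.1.1} → s.S :=
  fun n j => s.share j.1.1 ⟨n, j.1.2⟩ ω

/-- The collection of all shares of the messages `j` with `P j`. -/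
def Scheme.sharesOf (s : Scheme R X T K F L) (J : Finset (Msg K)) (ω : s.Ω) :
    (j : {j // j ∈ J}) → {n // n ∈ R j.1.1} → s.S :=
  fun j n => s.share j.1 n ω

/-- The answer of server `n` to the query `x`. -/
def Scheme.reply (s : Scheme R X T K F L) (n : Fin N) (x : MsgAt R K n → s.Q) (ω : s.Ω) :
    List F :=
  s.answer n x (atServer s.share n ω)

/-- The expected length of the answer of server `n` to the query `x`. -/
noncomputable def Scheme.replyLength (s : Scheme R X T K F L) (n : Fin N)
    (x : MsgAt R K n → s.Q) : ℝ :=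
  ∑ ω, weight s.p ω * (s.reply n x ω).length

/-- The expected number of symbols downloaded from server `n`. -/
noncomputable def Scheme.serverDownload (s : Scheme R X T K F L) (n : Fin N) : ℝ :=
  ∑ ω, weight s.p ω * (s.reply n (atServer s.qshare n ω) ω).length

lemma Scheme.serverDownload_nonneg (s : Scheme R X T K F L) (n : Fin N) :
    0 ≤ s.serverDownload n :=
  Finset.sum_nonneg fun ω _ => mul_nonneg (weight_nonneg _ ω) (Nat.cast_nonneg _)

lemma Scheme.download_eq (s : Scheme R X T K F L) :
    s.download = ENNReal.ofReal (∑ n, s.serverDownload n) := by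
  have h : ∑ n, s.serverDownload n = ∑ ω, weight s.p ω *
      ∑ n, ((s.answer n (atServer s.qshare n ω) (atServer s.share n ω)).length : ℝ) := by
    unfold Scheme.serverDownload
    rw [Finset.sum_comm]
    exact Finset.sum_congr rfl fun ω _ => (Finset.mul_sum _ _ _).symm
  rw [h, Scheme.download, ENNReal.ofReal_sum_of_nonneg fun ω _ =>
    mul_nonneg (weight_nonneg _ _) (Finset.sum_nonneg fun n _ => Nat.cast_nonneg _)]
  refine Finset.sum_congr rfl fun ω _ => ?_
  rw [ENNReal.ofReal_mul (weight_nonneg _ _), weight, ENNReal.ofReal_toReal (s.p.apply_ne_top ω)]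
  congr 1
  rw [ENNReal.ofReal_sum_of_nonneg fun n _ => Nat.cast_nonneg _]
  simp

lemma Scheme.queries_indep_of_storage (s : Scheme R X T K F L) (n : Fin N) :
    mutualInfo s.p (atServer s.qshare n) (atServer s.share n) = 0 := by
  have h := s.storage_indep
  rw [mutualInfo_comm] at h
  refine mutualInfo_eq_zero_of_determines_left _ (mutualInfo_eq_zero_of_determines_right _ h ?_) ?_
  · exact determines_of_comp (fun x => x ⟨n, Finset.mem_univ n⟩) fun _ => rfl
  · exact determines_of_comp (fun x => x.2 ⟨n, Finset.mem_univ n⟩) fun _ => rfl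

/-- The query and the storage of a server are independent, so the length may be averaged over the
storage first, with the query frozen. This is what allows the entropy arguments to be run for
deterministic queries. -/
lemma Scheme.serverDownload_eq (s : Scheme R X T K F L) (n : Fin N) :
    s.serverDownload n = ∑ ω, weight s.p ω * s.replyLength n (atServer s.qshare n ω) :=
  sum_weight_mul_of_mutualInfo_eq_zero s.p (s.queries_indep_of_storage n)
    fun x y => ((s.answer n x y).length : ℝ)

lemma Scheme.entropy_reply_le (s : Scheme R X T K F L) (n : Fin N) (x : MsgAt R K n → s.Q) :
    entropy s.p (s.reply n x) ≤ Real.log (Fintype.card F) * s.replyLength n x :=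
  entropy_le_expected_length s.p _ fun _ _ h => s.answer_prefix_free n x _ _ h

lemma Scheme.entropy_messages (s : Scheme R X T K F L) :
    entropy s.p s.W = Fintype.card (Msg K) * (L * Real.log (Fintype.card F)) := by
  classical
  rw [entropy_of_map_uniform s.p s.W_uniform]
  simp [Real.log_pow]

lemma Scheme.entropy_message_le (s : Scheme R X T K F L) (j : Msg K) :
    entropy s.p (fun ω => s.W ω j) ≤ L * Real.log (Fintype.card F) := by
  classical
  refine (entropy_le_log_card s.p _).trans (le_of_eq ?_)
  simp [Real.log_pow]

/-- The messages are mutually independent, each of them being uniform. -/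
lemma Scheme.entropy_message (s : Scheme R X T K F L) (j : Msg K) :
    entropy s.p (fun ω => s.W ω j) = L * Real.log (Fintype.card F) := by
  classical
  have h : entropy s.p s.W ≤ ∑ j, entropy s.p (fun ω => s.W ω j) :=
    le_trans (Determines.entropy_le (determines_of_comp
      (fun x j => x ⟨j, Finset.mem_univ j⟩) fun _ => rfl))
      (entropy_finset_le s.p Finset.univ fun j ω => s.W ω j)
  rw [s.entropy_messages] at h
  have h2 : ∑ j, entropy s.p (fun ω => s.W ω j) ≤
      ∑ _j : Msg K, (L * Real.log (Fintype.card F) : ℝ) :=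
    Finset.sum_le_sum fun j _ => s.entropy_message_le j
  have h3 : ∑ _j : Msg K, (L * Real.log (Fintype.card F) : ℝ) =
      Fintype.card (Msg K) * (L * Real.log (Fintype.card F)) := by
    rw [Finset.sum_const, nsmul_eq_mul, Finset.card_univ]
  exact (Finset.sum_eq_sum_iff_of_le fun j _ => s.entropy_message_le j).1
    (le_antisymm h2 (h3.trans_le h)) j (Finset.mem_univ j)

/-- The messages of one message set are independent. -/
lemma Scheme.entropy_messageSet (s : Scheme R X T K F L) (m : Fin M) :
    entropy s.p (fun ω (k : Fin (K m)) => s.W ω ⟨m, k⟩) =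
      ∑ k, entropy s.p (fun ω => s.W ω ⟨m, k⟩) := by
  classical
  refine le_antisymm ?_ ?_
  · exact le_trans (Determines.entropy_le (determines_of_comp
      (fun x k => x ⟨k, Finset.mem_univ k⟩) fun _ => rfl))
      (entropy_finset_le s.p Finset.univ fun k ω => s.W ω ⟨m, k⟩)
  · set J : Finset (Msg K) := Finset.univ.filter fun j => j.1 ≠ m
    have h1 : entropy s.p s.W ≤ entropy s.p (fun ω (k : Fin (K m)) => s.W ω ⟨m, k⟩) +
        ∑ j ∈ J, entropy s.p (fun ω => s.W ω j) := by
      refine le_trans ?_ ((entropy_pair_le s.p _ _).trans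
        (add_le_add_right (entropy_finset_le s.p J fun j ω => s.W ω j) _))
      refine Determines.entropy_le fun ω ω' _ _ h => funext fun j => ?_
      by_cases hj : j.1 = m
      · obtain ⟨m', k⟩ := j
        obtain rfl : m' = m := hj
        exact congrFun (Prod.ext_iff.1 h).1 k
      · exact congrFun (Prod.ext_iff.1 h).2 ⟨j, by simp [J, hj]⟩
    have h2 : entropy s.p s.W = ∑ j, entropy s.p (fun ω => s.W ω j) := by
      simp_rw [s.entropy_message, s.entropy_messages]
      simp
    have h3 : ∑ j, entropy s.p (fun ω => s.W ω j) =
        ∑ k, entropy s.p (fun ω => s.W ω ⟨m, k⟩) + ∑ j ∈ J, entropy s.p (fun ω => s.W ω j) := by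
      rw [← Finset.sum_filter_add_sum_filter_not Finset.univ fun j : Msg K => j.1 = m]
      congr 1
      symm
      refine Finset.sum_bij (fun k _ => ⟨m, k⟩) ?_ ?_ ?_ fun _ _ => rfl
      · simp
      · simp
      · rintro ⟨m', k⟩ hj
        obtain rfl : m' = m := (Finset.mem_filter.1 hj).2
        exact ⟨k, Finset.mem_univ k, rfl⟩
    linarith

/-- The shares of disjoint families of messages are independent. -/
lemma Scheme.sharesOf_indep [DecidableEq (Msg K)] (s : Scheme R X T K F L)
    (J : Finset (Msg K)) : mutualInfo s.p (s.sharesOf J) (s.sharesOf Jᶜ) = 0 := by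
  classical
  have h1 : entropy s.p (fun ω j n => s.share j n ω) ≤
      entropy s.p (fun ω => (s.sharesOf J ω, s.sharesOf Jᶜ ω)) := by
    refine Determines.entropy_le fun ω ω' _ _ h => funext fun j => ?_
    by_cases hj : j ∈ J
    · exact congrFun (Prod.ext_iff.1 h).1 ⟨j, hj⟩
    · exact congrFun (Prod.ext_iff.1 h).2 ⟨j, Finset.mem_compl.2 hj⟩
  have h2 : entropy s.p (s.sharesOf J) ≤ ∑ j ∈ J, entropy s.p (fun ω n => s.share j n ω) :=
    entropy_finset_le s.p J fun j ω n => s.share j n ω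
  have h3 : entropy s.p (s.sharesOf Jᶜ) ≤ ∑ j ∈ Jᶜ, entropy s.p (fun ω n => s.share j n ω) :=
    entropy_finset_le s.p Jᶜ fun j ω n => s.share j n ω
  have h4 := Finset.sum_add_sum_compl J fun j => entropy s.p (fun ω n => s.share j n ω)
  have h5 := entropy_pair_le s.p (s.sharesOf J) (s.sharesOf Jᶜ)
  have h6 := s.share_indep
  unfold mutualInfo
  linarith

open Classical in
/-- What is given away to the servers in the converse: the storage of `A` and all shares of the
messages outside of the `m`-th message set. -/
noncomputable def Scheme.sideInfo (s : Scheme R X T K F L) (m : Fin M) (A : Finset (Fin N))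
    (ω : s.Ω) :=
  (s.partialStorage (· = m) A ω, s.sharesOf (Finset.univ.filter fun j => j.1 = m)ᶜ ω)

/-- Security makes the storage of `A` independent of the messages of set `m`. Both are functions of
the shares of set `m`, so the pair is independent of the shares of all other messages; the two
independences combine. -/
lemma Scheme.messageSet_indep_sideInfo (s : Scheme R X T K F L) (m : Fin M)
    {A : Finset (Fin N)} (hA : A.card = X) :
    mutualInfo s.p (fun ω (k : Fin (K m)) => s.W ω ⟨m, k⟩) (s.sideInfo m A) = 0 := by
  classical
  set J : Finset (Msg K) := Finset.univ.filter fun j => j.1 = m with hJ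
  have h1 : mutualInfo s.p (fun ω (k : Fin (K m)) => s.W ω ⟨m, k⟩)
      (s.partialStorage (· = m) A) = 0 := by
    have h := s.secure A hA
    rw [mutualInfo_comm] at h
    refine mutualInfo_eq_zero_of_determines_left _
      (mutualInfo_eq_zero_of_determines_right _ h ?_) ?_
    · exact determines_of_comp (fun x n j => x n j.1) fun _ => rfl
    · exact determines_of_comp (fun x k => x ⟨m, k⟩) fun _ => rfl
  have hG : Determines s.p (s.sharesOf J) (s.partialStorage (· = m) A) :=
    determines_of_comp (fun x n j => x ⟨j.1.1, by simp [hJ, j.2]⟩ ⟨n, j.1.2⟩) fun _ => rfl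
  have hW : Determines s.p (s.sharesOf J) fun ω (k : Fin (K m)) => s.W ω ⟨m, k⟩ := by
    intro ω ω' hω hω' h
    funext k
    exact determines_of_condEntropy_eq_zero (s.W_recoverable ⟨m, k⟩) ω ω' hω hω'
      (congrFun h ⟨⟨m, k⟩, by simp [hJ]⟩)
  have h2 := mutualInfo_eq_zero_of_determines_left s.p (s.sharesOf_indep J)
    (Y' := fun ω => ((fun k : Fin (K m) => s.W ω ⟨m, k⟩), s.partialStorage (· = m) A ω))
    fun ω ω' hω hω' h => Prod.ext (hW ω ω' hω hω' h) (hG ω ω' hω hω' h)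
  have h3 := entropy_pair_le s.p (s.partialStorage (· = m) A) (s.sharesOf Jᶜ)
  have h4 := entropy_pair_le s.p (fun ω (k : Fin (K m)) => s.W ω ⟨m, k⟩) (s.sideInfo m A)
  have h5 : entropy s.p (fun ω => (((fun k : Fin (K m) => s.W ω ⟨m, k⟩),
      s.partialStorage (· = m) A ω), s.sharesOf Jᶜ ω)) =
      entropy s.p (fun ω => ((fun k : Fin (K m) => s.W ω ⟨m, k⟩), s.sideInfo m A ω)) :=
    entropy_congr (determines_of_comp (fun x => ((x.1, x.2.1), x.2.2)) fun _ => rfl)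
      (determines_of_comp (fun x => (x.1.1, x.1.2, x.2)) fun _ => rfl)
  have h6 : s.sideInfo m A = fun ω => (s.partialStorage (· = m) A ω, s.sharesOf Jᶜ ω) := by
    funext ω
    rfl
  rw [← h6] at h3
  unfold mutualInfo at *
  linarith

/-- The joint law of the storage, the coefficients and the queries is a product. -/
lemma Scheme.exists_coupling (s : Scheme R X T K F L) {ω ω' : s.Ω} (hω : 0 < weight s.p ω)
    (hω' : 0 < weight s.p ω') : ∃ ω'', 0 < weight s.p ω'' ∧
      (∀ j n, s.share j n ω'' = s.share j n ω) ∧ (∀ j n, s.qshare j n ω'' = s.qshare j n ω') ∧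
      s.lam ω'' = s.lam ω' := by
  have h := prob_pair_of_mutualInfo_eq_zero s.p s.storage_indep (atServers s.share Finset.univ ω)
    (s.lam ω', atServers s.qshare Finset.univ ω')
  have hpos := mul_pos (prob_pos s.p (Z := atServers s.share Finset.univ) hω)
    (prob_pos s.p (Z := fun ω => (s.lam ω, atServers s.qshare Finset.univ ω)) hω')
  rw [← h] at hpos
  obtain ⟨ω'', h'', he⟩ := exists_of_prob_pos s.p hpos
  simp only [Prod.mk.injEq] at he
  refine ⟨ω'', h'', fun j n => ?_, fun j n => ?_, he.2.1⟩
  · exact congrFun (congrFun he.1 ⟨n.1, Finset.mem_univ _⟩) ⟨j, n.2⟩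
  · exact congrFun (congrFun he.2.2 ⟨n.1, Finset.mem_univ _⟩) ⟨j, n.2⟩

/-- When the user asks for message `(m, k)`, the answers of the servers outside of `A` that
store the `m`-th message set determine that message, given the side information. -/
lemma Scheme.determines_message [DecidableEq (Msg K)] (s : Scheme R X T K F L) (m : Fin M)
    (k : Fin (K m)) {A B C : Finset (Fin N)} (hABC : R m ⊆ A ∪ B ∪ C) {ω₀ : s.Ω}
    (h₀ : 0 < weight s.p ω₀) (hl : s.lam ω₀ = selector F L ⟨m, k⟩) :
    Determines s.p (fun ω => ((fun n : {n // n ∈ C} => s.reply n (atServer s.qshare n ω₀) ω),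
      (fun n : {n // n ∈ B} => s.reply n (atServer s.qshare n ω₀) ω), s.sideInfo m A ω))
      (fun ω => s.W ω ⟨m, k⟩) := by
  intro ω ω' hω hω' h
  obtain ⟨ω₁, h₁, hs₁, hq₁, hl₁⟩ := s.exists_coupling hω h₀
  obtain ⟨ω₂, h₂, hs₂, hq₂, hl₂⟩ := s.exists_coupling hω' h₀
  have hrec : ∀ {ω ω'' : s.Ω}, 0 < weight s.p ω → 0 < weight s.p ω'' →
      (∀ j n, s.share j n ω'' = s.share j n ω) → s.W ω'' ⟨m, k⟩ = s.W ω ⟨m, k⟩ :=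
    fun {ω ω''} h h'' hs => determines_of_condEntropy_eq_zero (s.W_recoverable ⟨m, k⟩) ω'' ω h'' h
      (funext fun n => hs _ n)
  simp only [Prod.mk.injEq, Scheme.sideInfo] at h
  obtain ⟨hC, hB, hA, hO⟩ := h
  have hans : ∀ n, s.reply n (atServer s.qshare n ω₀) ω = s.reply n (atServer s.qshare n ω₀) ω' :=
    fun n => by
    by_cases hnC : n ∈ C
    · exact congrFun hC ⟨n, hnC⟩
    by_cases hnB : n ∈ B
    · exact congrFun hB ⟨n, hnB⟩
    -- For a server outside `B ∪ C`, the whole storage is side information: a share from set `m` can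
    -- only be there if `n ∈ R m`, hence `n ∈ A`, and all other shares are given away.
    have : atServer s.share n ω = atServer s.share n ω' := by
      funext j
      by_cases hj : j.1.1 = m
      · have hnA : n ∈ A := by
          have := hABC (hj ▸ j.2)
          simpa [hnC, hnB] using this
        exact congrFun (congrFun hA ⟨n, hnA⟩) ⟨j, hj⟩
      · exact congrFun (congrFun hO ⟨j.1, by simp [hj]⟩) ⟨n, j.2⟩
    unfold Scheme.reply
    rw [this]
  have hs₁' : ∀ n, atServer s.share n ω₁ = atServer s.share n ω := fun n =>
    funext fun j => hs₁ _ _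
  have hs₂' : ∀ n, atServer s.share n ω₂ = atServer s.share n ω' := fun n =>
    funext fun j => hs₂ _ _
  have hq₁' : ∀ n, atServer s.qshare n ω₁ = atServer s.qshare n ω₀ := fun n =>
    funext fun j => hq₁ _ _
  have hq₂' : ∀ n, atServer s.qshare n ω₂ = atServer s.qshare n ω₀ := fun n =>
    funext fun j => hq₂ _ _
  have hc := determines_of_condEntropy_eq_zero s.correct ω₁ ω₂ h₁ h₂ (by
    simp only [Prod.mk.injEq]
    refine ⟨funext fun n => ?_, funext fun n => (hq₁' n).trans (hq₂' n).symm, hl₁.trans hl₂.symm⟩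
    rw [hs₁', hs₂', hq₁', hq₂']
    exact hans n)
  simp only [hl₁, hl₂, hl, linComb_selector] at hc
  exact (hrec hω h₁ hs₁).symm.trans (hc.trans (hrec hω' h₂ hs₂))

/-- What the answers of the servers of `B` to the query `x` reveal about message `(m, k)`. -/
noncomputable def Scheme.leakage (s : Scheme R X T K F L) (m : Fin M) (A B : Finset (Fin N))
    (k : Fin (K m)) (x : (n : {n // n ∈ B}) → MsgAt R K n.1 → s.Q) : ℝ :=
  entropy s.p (fun ω => (s.W ω ⟨m, k⟩, s.sideInfo m A ω)) +
    entropy s.p (fun ω => ((fun n : {n // n ∈ B} => s.reply n (x n) ω), s.sideInfo m A ω)) -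
    entropy s.p (fun ω => (s.W ω ⟨m, k⟩, (fun n : {n // n ∈ B} => s.reply n (x n) ω),
      s.sideInfo m A ω)) - entropy s.p (s.sideInfo m A)

/-- The leakage is the conditional mutual information given the side information. For one fixed
query the messages of set `m` are independent, so they compete for the entropy of the same answers.
-/
lemma Scheme.sum_leakage_le (s : Scheme R X T K F L) (m : Fin M) {A : Finset (Fin N)}
    (B : Finset (Fin N)) (hA : A.card = X)
    (x : (n : {n // n ∈ B}) → MsgAt R K n.1 → s.Q) :
    ∑ k, s.leakage m A B k x ≤
      Real.log (Fintype.card F) * ∑ n : {n // n ∈ B}, s.replyLength n (x n) := by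
  classical
  refine (sum_condMutualInfo_le s.p (fun k ω => s.W ω ⟨m, k⟩) _ _ (s.entropy_messageSet m)
    (s.messageSet_indep_sideInfo m hA)).trans ?_
  rw [Finset.mul_sum]
  refine le_trans ?_ (Finset.sum_le_sum fun n _ => s.entropy_reply_le n (x n))
  exact le_trans (Determines.entropy_le (determines_of_comp
    (fun y n => y ⟨n, Finset.mem_univ n⟩) fun _ => rfl))
    (entropy_finset_le s.p Finset.univ fun (n : {n // n ∈ B}) ω => s.reply n (x n) ω)

/-- The message has entropy `L log q` given the side information. Adding the answers of `C` to those
of `B` makes it known, so whatever the answers of `B` leave uncertain is bounded by the entropy of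
the answers of `C`. -/
lemma Scheme.message_le_leakage_add [DecidableEq (Msg K)] (s : Scheme R X T K F L) (m : Fin M)
    (k : Fin (K m)) {A B C : Finset (Fin N)} (hABC : R m ⊆ A ∪ B ∪ C) (hA : A.card = X)
    {ω₀ : s.Ω} (h₀ : 0 < weight s.p ω₀) (hl : s.lam ω₀ = selector F L ⟨m, k⟩) :
    L * Real.log (Fintype.card F) ≤ s.leakage m A B k (atServers s.qshare B ω₀) +
      Real.log (Fintype.card F) * ∑ n ∈ C, s.replyLength n (atServer s.qshare n ω₀) := by
  classical
  have hdet := s.determines_message m k hABC h₀ hl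
  set AC := fun ω => fun n : {n // n ∈ C} => s.reply n (atServer s.qshare n ω₀) ω
  set AB := fun ω => fun n : {n // n ∈ B} => s.reply n (atServer s.qshare n ω₀) ω
  have h1 : entropy s.p (fun ω => (s.W ω ⟨m, k⟩, AB ω, s.sideInfo m A ω)) ≤
      entropy s.p (fun ω => (AC ω, AB ω, s.sideInfo m A ω)) :=
    Determines.entropy_le fun ω ω' hω hω' h =>
      Prod.ext (hdet ω ω' hω hω' h) (Prod.ext_iff.1 h).2
  have h2 := entropy_pair_le s.p AC fun ω => (AB ω, s.sideInfo m A ω)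
  have h3 : entropy s.p AC ≤ Real.log (Fintype.card F) *
      ∑ n ∈ C, s.replyLength n (atServer s.qshare n ω₀) := by
    rw [Finset.mul_sum]
    exact (entropy_finset_le s.p C fun n => s.reply n (atServer s.qshare n ω₀)).trans
      (Finset.sum_le_sum fun n _ => s.entropy_reply_le n _)
  have h4 := mutualInfo_eq_zero_of_determines_left s.p (s.messageSet_indep_sideInfo m hA)
    (determines_of_comp (Y := fun ω => s.W ω ⟨m, k⟩) (fun x => x k) fun _ => rfl)
  have h5 := s.entropy_message ⟨m, k⟩
  have h6 : s.leakage m A B k (atServers s.qshare B ω₀) =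
      entropy s.p (fun ω => (s.W ω ⟨m, k⟩, s.sideInfo m A ω)) +
      entropy s.p (fun ω => (AB ω, s.sideInfo m A ω)) -
      entropy s.p (fun ω => (s.W ω ⟨m, k⟩, AB ω, s.sideInfo m A ω)) -
      entropy s.p (s.sideInfo m A) := rfl
  unfold mutualInfo at h4
  linarith

lemma Scheme.prob_lam_pos (s : Scheme R X T K F L) (x : Msg K → Fin L → F) :
    0 < prob s.p s.lam x := by
  classical
  rw [← map_apply_toReal, s.lam_uniform, PMF.uniformOfFintype_apply]
  simp only [ENNReal.toReal_inv, ENNReal.toReal_natCast]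
  exact inv_pos.2 (by exact_mod_cast Fintype.card_pos)

/-- By privacy, expectations of functions of the queries of few servers are not affected by the
values of the coefficients. -/
lemma Scheme.le_expectation_of_forall_lam_eq (s : Scheme R X T K F L) {B : Finset (Fin N)}
    (hB : B.card = T) (x : Msg K → Fin L → F) {ι : Type} [Fintype ι]
    (f : ((n : {n // n ∈ B}) → MsgAt R K n.1 → s.Q) → ℝ)
    (n : ι → Fin N) (hT : 1 ≤ T) (hTN : T < N) (g : (i : ι) → (MsgAt R K (n i) → s.Q) → ℝ)
    (c : ℝ) (h : ∀ ω, 0 < weight s.p ω → s.lam ω = x →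
      c ≤ f (atServers s.qshare B ω) + ∑ i, g i (atServer s.qshare (n i) ω)) :
    c ≤ ∑ ω, weight s.p ω * f (atServers s.qshare B ω) +
      ∑ i, ∑ ω, weight s.p ω * g i (atServer s.qshare (n i) ω) := by
  classical
  have hf := sum_ite_weight_mul_of_mutualInfo_eq_zero s.p (s.isPrivate B hB) f x
  have hg : ∀ i, ∑ ω, (if s.lam ω = x then weight s.p ω * g i (atServer s.qshare (n i) ω) else 0)
      = prob s.p s.lam x * ∑ ω, weight s.p ω * g i (atServer s.qshare (n i) ω) := fun i => by
    -- Privacy is assumed for sets of exactly `T` servers; since `1 ≤ T ≤ N`, a single server lies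
    -- in such a set.
    obtain ⟨B', hsub, -, hB'⟩ := Finset.exists_subsuperset_card_eq
      (Finset.subset_univ {n i}) (n := T) (by simpa using hT) (by simpa using hTN.le)
    exact sum_ite_weight_mul_of_mutualInfo_eq_zero s.p
      (mutualInfo_eq_zero_of_determines_left s.p (s.isPrivate B' hB')
        (determines_of_comp (Y := atServer s.qshare (n i))
          (fun y => y ⟨n i, hsub (Finset.mem_singleton_self _)⟩) fun _ => rfl)) (g i) x
  have hc : prob s.p s.lam x * c = ∑ ω, if s.lam ω = x then weight s.p ω * c else 0 := by
    rw [prob, Finset.sum_mul]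
    exact Finset.sum_congr rfl fun ω _ => by split_ifs <;> simp
  refine le_of_mul_le_mul_left ?_ (s.prob_lam_pos x)
  rw [mul_add, ← hf, hc, Finset.mul_sum, ← Finset.sum_congr rfl fun i _ => hg i, Finset.sum_comm,
    ← Finset.sum_add_distrib]
  refine Finset.sum_le_sum fun ω _ => ?_
  by_cases hx : s.lam ω = x
  · simp only [hx, if_true]
    rcases weight_eq_zero_or_pos s.p ω with h0 | h0
    · simp [h0]
    · rw [← Finset.mul_sum, ← mul_add]
      exact mul_le_mul_of_nonneg_left (h ω h0 hx) h0.le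
  · simp [hx]

/-- The converse bound: if `R m ⊆ A ∪ B ∪ C` with `A` a set of `X` and `B` a set of `T` servers,
then `L ≤ ∑_{n ∈ C} D_n + (1 / K_m) ∑_{n ∈ B} D_n`. -/
lemma Scheme.converse_bound (s : Scheme R X T K F L) (hT : 1 ≤ T) (hTN : T < N) (m : Fin M)
    {A B C : Finset (Fin N)} (hABC : R m ⊆ A ∪ B ∪ C) (hA : A.card = X) (hB : B.card = T) :
    (K m : ℝ) * L ≤ K m * ∑ n ∈ C, s.serverDownload n + ∑ n ∈ B, s.serverDownload n := by
  classical
  set q := Real.log (Fintype.card F)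
  have hq : 0 < q := Real.log_pos (by exact_mod_cast Fintype.one_lt_card)
  have h1 : ∀ k : Fin (K m), L * q ≤
      ∑ ω, weight s.p ω * s.leakage m A B k (atServers s.qshare B ω) +
      q * ∑ n ∈ C, s.serverDownload n := fun k => by
    have := s.le_expectation_of_forall_lam_eq hB (selector F L ⟨m, k⟩) (s.leakage m A B k)
      (fun i : {n // n ∈ C} => i.1) hT hTN (fun i x => q * s.replyLength i x) (L * q)
      fun ω hω hl => by
        rw [← Finset.mul_sum,
          Finset.sum_coe_sort C fun n => s.replyLength n (atServer s.qshare n ω)]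
        exact s.message_le_leakage_add m k hABC hA hω hl
    refine this.trans (le_of_eq ?_)
    congr 1
    rw [← Finset.sum_coe_sort C fun n => s.serverDownload n, Finset.mul_sum]
    refine Finset.sum_congr rfl fun i _ => ?_
    rw [s.serverDownload_eq, Finset.mul_sum]
    exact Finset.sum_congr rfl fun ω _ => by ring
  -- All leakages are now averaged over the same unconditioned queries of `B`, so they can be summed
  -- over `k` for each query separately.
  have h2 : ∑ k, ∑ ω, weight s.p ω * s.leakage m A B k (atServers s.qshare B ω) ≤
      q * ∑ n ∈ B, s.serverDownload n := by
    rw [Finset.sum_comm]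
    simp_rw [← Finset.mul_sum]
    refine (sum_weight_mul_le s.p fun ω _ => s.sum_leakage_le m B hA _).trans (le_of_eq ?_)
    rw [← Finset.sum_coe_sort B fun n => s.serverDownload n]
    simp_rw [s.serverDownload_eq, Finset.mul_sum]
    rw [Finset.sum_comm]
    refine Finset.sum_congr rfl fun n _ => Finset.sum_congr rfl fun ω _ => ?_
    rw [mul_left_comm]
    rfl
  have h3 := Finset.sum_le_sum fun (k : Fin (K m)) (_ : k ∈ Finset.univ) => h1 k
  rw [Finset.sum_add_distrib] at h3
  simp only [Finset.sum_const, Finset.card_univ, Fintype.card_fin, nsmul_eq_mul] at h3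
  refine le_of_mul_le_mul_left ?_ hq
  linarith

end Converse

/-! ### Entropy of homomorphisms on a uniformly distributed finite group. -/

section UniformGroup

variable {G A B : Type} [AddGroup G] [Fintype G] [AddGroup A]

/-- The fibres of a homomorphism are translates of its kernel, so its law is uniform on its image.
Entropy and independence thereby reduce to counting images. -/
lemma prob_uniform_of_map_add [DecidableEq A] {Z : G → A} (hZ : ∀ a b, Z (a + b) = Z a + Z b)
    (g : G) : prob (PMF.uniformOfFintype G) Z (Z g) = ((Finset.univ.image Z).card : ℝ)⁻¹ := by
  classical
  set p := PMF.uniformOfFintype G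
  have hw : ∀ a b : G, weight p a = weight p b := fun a b => by simp [weight, p]
  have hshift : ∀ g, prob p Z (Z g) = prob p Z 0 := fun g => by
    unfold prob
    rw [← Equiv.sum_comp (Equiv.addRight g)]
    refine Finset.sum_congr rfl fun h _ => ?_
    rw [Equiv.coe_addRight, hZ, hw (h + g) h]
    simp
  have hsum := sum_prob p Z
  have : ∀ x ∈ Finset.univ.image Z, prob p Z x = prob p Z 0 := fun x hx => by
    obtain ⟨g, -, rfl⟩ := Finset.mem_image.1 hx
    exact hshift g
  rw [Finset.sum_congr rfl this, Finset.sum_const, nsmul_eq_mul] at hsum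
  rw [hshift]
  exact eq_inv_of_mul_eq_one_right hsum

/-- The entropy of a homomorphism under the uniform distribution. -/
lemma entropy_uniform_of_map_add [DecidableEq A] {Z : G → A}
    (hZ : ∀ a b, Z (a + b) = Z a + Z b) :
    entropy (PMF.uniformOfFintype G) Z = Real.log (Finset.univ.image Z).card := by
  rw [entropy_eq_sum]
  simp_rw [prob_uniform_of_map_add hZ, Real.log_inv, neg_neg, ← Finset.sum_mul, sum_weight,
    one_mul]

lemma map_uniform_of_surjective [Fintype A] {Z : G → A} (hZ : ∀ a b, Z (a + b) = Z a + Z b)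
    (hs : Function.Surjective Z) :
    (PMF.uniformOfFintype G).map Z = PMF.uniformOfFintype A := by
  classical
  ext x
  obtain ⟨g, rfl⟩ := hs x
  rw [← ENNReal.toReal_eq_toReal_iff' (PMF.apply_ne_top _ _) (PMF.apply_ne_top _ _),
    map_apply_toReal, prob_uniform_of_map_add hZ, Finset.image_univ_of_surjective hs]
  simp

/-- The hypothesis `h` says that the joint image is the product of the two images, and the
logarithms of the cardinalities add up. -/
lemma mutualInfo_uniform_eq_zero [AddGroup B] {Y : G → A} {Z : G → B}
    (hY : ∀ a b, Y (a + b) = Y a + Y b) (hZ : ∀ a b, Z (a + b) = Z a + Z b)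
    (h : ∀ g g', ∃ g'', Y g'' = Y g ∧ Z g'' = Z g') :
    mutualInfo (PMF.uniformOfFintype G) Y Z = 0 := by
  classical
  have himg : Finset.univ.image (fun g => (Y g, Z g)) =
      Finset.univ.image Y ×ˢ Finset.univ.image Z := by
    ext ⟨y, z⟩
    simp only [Finset.mem_image, Finset.mem_univ, true_and, Finset.mem_product, Prod.mk.injEq]
    constructor
    · rintro ⟨g, rfl, rfl⟩
      exact ⟨⟨g, rfl⟩, g, rfl⟩
    · rintro ⟨⟨g, rfl⟩, g', rfl⟩
      exact h g g'
  have hne : ∀ {C : Type} [DecidableEq C] (V : G → C),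
      ((Finset.univ.image V).card : ℝ) ≠ 0 := fun V =>
    Nat.cast_ne_zero.2 (Finset.card_pos.2 ⟨V 0, Finset.mem_image_of_mem V (Finset.mem_univ 0)⟩).ne'
  rw [mutualInfo, entropy_uniform_of_map_add hY, entropy_uniform_of_map_add hZ,
    entropy_uniform_of_map_add (Z := fun g => (Y g, Z g)) fun a b => by rw [hY, hZ]; rfl,
    himg, Finset.card_product, Nat.cast_mul, Real.log_mul (hne Y) (hne Z), sub_self]

lemma entropy_uniform_pi {ι : Type} [Fintype ι] {α : ι → Type} [∀ i, AddGroup (α i)]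
    {Z : G → (i : ι) → α i} (hZ : ∀ a b, Z (a + b) = Z a + Z b)
    (h : ∀ g : ι → G, ∃ g', ∀ i, Z g' i = Z (g i) i) :
    entropy (PMF.uniformOfFintype G) Z =
      ∑ i, entropy (PMF.uniformOfFintype G) fun g => Z g i := by
  classical
  have himg : Finset.univ.image Z =
      Fintype.piFinset fun i => Finset.univ.image fun g => Z g i := by
    ext x
    simp only [Finset.mem_image, Finset.mem_univ, true_and, Fintype.mem_piFinset]
    constructor
    · rintro ⟨g, rfl⟩ i
      exact ⟨g, rfl⟩
    · intro hx
      choose g hg using hx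
      obtain ⟨g', hg'⟩ := h g
      exact ⟨g', funext fun i => (hg' i).trans (hg i)⟩
  rw [entropy_uniform_of_map_add hZ, himg, Fintype.card_piFinset, Nat.cast_prod,
    Real.log_prod fun i _ => Nat.cast_ne_zero.2 (Finset.card_pos.2
      ⟨Z 0 i, Finset.mem_image_of_mem (fun g => Z g i) (Finset.mem_univ 0)⟩).ne']
  exact Finset.sum_congr rfl fun i _ =>
    (entropy_uniform_of_map_add fun a b => by rw [hZ]; rfl).symm

end UniformGroup

section Replicated

/-! Replicated secret sharing: a secret is a sum of terms indexed by the sets `S` of `t` servers,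
and the term of `S` is given to the servers outside of `S`. -/

variable {N M : ℕ} {R : Fin M → Finset (Fin N)} {K : Fin M → ℕ} {V : Type} [AddCommGroup V]

/-- The share of server `n`: the terms of the sets that do not contain `n`. -/
def replicatedShare (a : Msg K → Finset (Fin N) → V) (j : Msg K) (n : Fin N) :
    Finset (Fin N) → V :=
  fun S => if n ∈ S then 0 else a j S

/-- The secret: the sum of all the terms. -/
def replicatedSecret (R : Fin M → Finset (Fin N)) (t : ℕ) (a : Msg K → Finset (Fin N) → V)
    (j : Msg K) : V :=
  ∑ S ∈ (R j.1).powersetCard t, a j S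

lemma replicatedShare_add (a b : Msg K → Finset (Fin N) → V) (j : Msg K) (n : Fin N) :
    replicatedShare (a + b) j n = replicatedShare a j n + replicatedShare b j n := by
  funext S
  simp only [replicatedShare, Pi.add_apply]
  split_ifs <;> simp

lemma replicatedSecret_add (t : ℕ) (a b : Msg K → Finset (Fin N) → V) :
    replicatedSecret R t (a + b) = replicatedSecret R t a + replicatedSecret R t b := by
  funext j
  simp [replicatedSecret, Finset.sum_add_distrib]

/-- A set of `t < |R j.1|` servers misses some server of `R j.1`, so no term is hidden from
everyone. -/
lemma replicatedSecret_eq_of_share_eq {t : ℕ} {a b : Msg K → Finset (Fin N) → V} {j : Msg K}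
    (ht : t < (R j.1).card)
    (h : ∀ n ∈ R j.1, replicatedShare a j n = replicatedShare b j n) :
    replicatedSecret R t a j = replicatedSecret R t b j := by
  refine Finset.sum_congr rfl fun S hS => ?_
  obtain ⟨n, hn, hnS⟩ : ∃ n ∈ R j.1, n ∉ S := by
    by_contra! hc
    exact absurd (Finset.card_le_card hc) (by rw [(Finset.mem_powersetCard.1 hS).2]; omega)
  simpa [replicatedShare, hnS] using congrFun (h n hn) S

lemma exists_replicatedSecret_eq {t : ℕ} (ht : ∀ m, t ≤ (R m).card) (w : Msg K → V) :
    ∃ a, replicatedSecret R t a = w := by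
  have hS : ∀ j : Msg K, ∃ S, S ∈ (R j.1).powersetCard t := fun j =>
    Finset.powersetCard_nonempty.2 (ht j.1)
  choose S hS using hS
  refine ⟨fun j => Function.update 0 (S j) (w j), funext fun j => ?_⟩
  rw [replicatedSecret, Finset.sum_update_of_mem (hS j)]
  simp

/-- Security: `t` shares can be completed to a sharing of any secret. -/
lemma exists_replicatedShare_secret {t : ℕ} (ht : ∀ m, t ≤ (R m).card) {A : Finset (Fin N)}
    (hA : A.card = t) (a b : Msg K → Finset (Fin N) → V) :
    ∃ c : Msg K → Finset (Fin N) → V,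
      (∀ j, ∀ n ∈ A, n ∈ R j.1 → replicatedShare c j n = replicatedShare a j n) ∧
      replicatedSecret R t c = replicatedSecret R t b := by
  -- The at most `t` servers of `A ∩ R j.1` fit into one `t`-set `S`. None of them sees the term of
  -- `S`, so this term can be altered to reach any secret.
  have hS : ∀ j : Msg K, ∃ S ∈ (R j.1).powersetCard t, A ∩ R j.1 ⊆ S := fun j => by
    obtain ⟨S, h1, h2, h3⟩ := Finset.exists_subsuperset_card_eq
      (Finset.inter_subset_right : A ∩ R j.1 ⊆ R j.1) (n := t)
      (hA ▸ Finset.card_le_card Finset.inter_subset_left) (ht j.1)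
    exact ⟨S, Finset.mem_powersetCard.2 ⟨h2, h3⟩, h1⟩
  choose S hS hAS using hS
  refine ⟨fun j => Function.update (a j) (S j)
    (replicatedSecret R t b j - ∑ S' ∈ (R j.1).powersetCard t \ {S j}, a j S'), ?_, ?_⟩
  · intro j n hn hnR
    funext S'
    by_cases h : n ∈ S'
    · simp [replicatedShare, h]
    · have : S' ≠ S j := fun he => h (he ▸ hAS j (Finset.mem_inter.2 ⟨hn, hnR⟩))
      simp [replicatedShare, h, Function.update_of_ne this]
  · funext j
    rw [replicatedSecret, Finset.sum_update_of_mem (hS j)]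
    abel

variable {G : Type} [AddGroup G] {π : G → Msg K → Finset (Fin N) → V}

lemma atServers_replicatedShare_add (hπ : ∀ a b, π (a + b) = π a + π b) (A : Finset (Fin N))
    (a b : G) :
    atServers (R := R) (fun j n g => replicatedShare (π g) j n.1) A (a + b) =
      atServers (R := R) (fun j n g => replicatedShare (π g) j n.1) A a +
        atServers (R := R) (fun j n g => replicatedShare (π g) j n.1) A b := by
  funext n j
  simp only [atServers, atServer, hπ, replicatedShare_add, Pi.add_apply]

variable [Fintype G]

lemma mutualInfo_replicatedShare {t : ℕ} (ht : ∀ m, t ≤ (R m).card)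
    (hπ : ∀ a b, π (a + b) = π a + π b) (hs : Function.Surjective π) {A : Finset (Fin N)}
    (hA : A.card = t) :
    mutualInfo (PMF.uniformOfFintype G)
      (atServers (R := R) (fun j n g => replicatedShare (π g) j n.1) A)
      (fun g => replicatedSecret R t (π g)) = 0 := by
  refine mutualInfo_uniform_eq_zero (atServers_replicatedShare_add hπ A)
    (fun a b => by rw [hπ, replicatedSecret_add]) fun a b => ?_
  obtain ⟨c, h1, h2⟩ := exists_replicatedShare_secret ht hA (π a) (π b)
  obtain ⟨g, rfl⟩ := hs c
  exact ⟨g, funext fun n => funext fun j => h1 j.1 n n.2 j.2, h2⟩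

lemma entropy_replicatedShare (hπ : ∀ a b, π (a + b) = π a + π b)
    (hs : Function.Surjective π) :
    entropy (PMF.uniformOfFintype G)
      (fun g (j : Msg K) (n : {n // n ∈ R j.1}) => replicatedShare (π g) j n.1) =
    ∑ j : Msg K, entropy (PMF.uniformOfFintype G)
      (fun g (n : {n // n ∈ R j.1}) => replicatedShare (π g) j n.1) := by
  refine entropy_uniform_pi (fun a b => ?_) fun g => ?_
  · funext j n
    simp only [hπ, replicatedShare_add, Pi.add_apply]
  · obtain ⟨g', hg'⟩ := hs fun j => π (g j) j
    refine ⟨g', fun j => ?_⟩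
    rw [hg']
    rfl

lemma map_replicatedSecret [Fintype V] {t : ℕ} (ht : ∀ m, t ≤ (R m).card)
    (hπ : ∀ a b, π (a + b) = π a + π b) (hs : Function.Surjective π) :
    (PMF.uniformOfFintype G).map (fun g => replicatedSecret R t (π g)) =
      PMF.uniformOfFintype (Msg K → V) := by
  refine map_uniform_of_surjective (fun a b => by rw [hπ, replicatedSecret_add]) fun w => ?_
  obtain ⟨a, ha⟩ := exists_replicatedSecret_eq ht w
  obtain ⟨g, rfl⟩ := hs a
  exact ⟨g, ha⟩

lemma mutualInfo_replicatedShare_prod [Fintype V] (t : ℕ) (A : Finset (Fin N)) :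
    mutualInfo (PMF.uniformOfFintype
      ((Msg K → Finset (Fin N) → V) × (Msg K → Finset (Fin N) → V)))
      (atServers (R := R) (fun j n g => replicatedShare g.1 j n.1) A)
      (fun g => (replicatedSecret R t g.2,
        atServers (R := R) (fun j n g => replicatedShare g.2 j n.1) A g)) = 0 := by
  refine mutualInfo_uniform_eq_zero (atServers_replicatedShare_add (π := Prod.fst)
    (fun _ _ => rfl) A) (fun a b => ?_) fun a b => ⟨(a.1, b.2), rfl, rfl⟩
  exact Prod.ext (replicatedSecret_add t a.2 b.2)
    (atServers_replicatedShare_add (π := Prod.snd) (fun _ _ => rfl) A a b)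

end Replicated

/-! ### The scheme: coding over general-position vectors and decoding. -/

section Achievability

variable {N M : ℕ} {R : Fin M → Finset (Fin N)} {X T : ℕ} {K : Fin M → ℕ}
  {F : Type} [Field F] {L : ℕ} {d : Fin N → ℕ}

/-- Every vector is a combination of the vectors `v a` that belong to the servers in `A`. -/
def SpansAt (v : (Σ n, Fin (d n)) → Fin L → F) (A : Finset (Fin N)) : Prop :=
  ∀ z : Fin L → F, ∃ y : (Σ n, Fin (d n)) → F,
    (∀ a, a.1 ∉ A → y a = 0) ∧ ∀ ℓ, ∑ a, y a * v a ℓ = z ℓ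

/-- Vandermonde vectors are in general position. -/
lemma spansAt_vandermonde {x : (Σ n, Fin (d n)) → F} (hx : Function.Injective x)
    {A : Finset (Fin N)} (hA : L ≤ ∑ n ∈ A, d n) :
    SpansAt (fun a (ℓ : Fin L) => x a ^ (ℓ : ℕ)) A := by
  classical
  intro z
  -- Any `L` of the available vectors form an invertible square Vandermonde matrix.
  obtain ⟨e⟩ : Nonempty (Fin L ↪ {a : Σ n, Fin (d n) // a ∈ A.sigma fun _ => Finset.univ}) :=
    Function.Embedding.nonempty_of_card_le (by
      rw [Fintype.card_coe, Finset.card_sigma]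
      simpa using hA)
  set V := Matrix.vandermonde fun k => x (e k).1
  have hdet : IsUnit V.det := isUnit_iff_ne_zero.2
    (Matrix.det_vandermonde_ne_zero_iff.2 (hx.comp (Subtype.val_injective.comp e.injective)))
  set c := Matrix.vecMul z V⁻¹
  have hc : Matrix.vecMul c V = z := by
    rw [Matrix.vecMul_vecMul, Matrix.nonsing_inv_mul _ hdet, Matrix.vecMul_one]
  refine ⟨fun a => ∑ k, if (e k).1 = a then c k else 0, fun a ha => ?_, fun ℓ => ?_⟩
  · refine Finset.sum_eq_zero fun k _ => if_neg fun h => ha ?_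
    rw [← h]
    exact (Finset.mem_sigma.1 (e k).2).1
  · simp_rw [Finset.sum_mul]
    rw [Finset.sum_comm, ← congrFun hc ℓ]
    refine Finset.sum_congr rfl fun k _ => ?_
    simp [V, Matrix.vandermonde]

open Classical in
/-- Coefficients of `z` with respect to the vectors of the servers in `A`. -/
noncomputable def coordinates (v : (Σ n, Fin (d n)) → Fin L → F) (A : Finset (Fin N))
    (z : Fin L → F) : (Σ n, Fin (d n)) → F :=
  if h : SpansAt v A then (h z).choose else 0

lemma coordinates_eq_zero {v : (Σ n, Fin (d n)) → Fin L → F} {A : Finset (Fin N)}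
    (z : Fin L → F) {a : Σ n, Fin (d n)} (ha : a.1 ∉ A) : coordinates v A z a = 0 := by
  unfold coordinates
  split_ifs with h
  · exact (h z).choose_spec.1 a ha
  · rfl

lemma sum_coordinates {v : (Σ n, Fin (d n)) → Fin L → F} {A : Finset (Fin N)}
    (h : SpansAt v A) (z : Fin L → F) (ℓ : Fin L) :
    ∑ a, coordinates v A z a * v a ℓ = z ℓ := by
  unfold coordinates
  rw [dif_pos h]
  exact (h z).choose_spec.2 ℓ

/-- The symbols sent by server `n` when its storage is `s` and its query is `q`. -/
noncomputable def answerSymbol (R : Fin M → Finset (Fin N)) (X T : ℕ) (K : Fin M → ℕ)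
    (v : (Σ n, Fin (d n)) → Fin L → F) (n : Fin N)
    (q s : MsgAt R K n → Finset (Fin N) → Fin L → F) (i : Fin (d n)) : F :=
  ∑ j : MsgAt R K n, ∑ S ∈ (R j.1.1).powersetCard X, ∑ U ∈ (R j.1.1).powersetCard T,
    coordinates v (R j.1.1 \ (S ∪ U)) (s j S * q j U) ⟨n, i⟩

/-- Coordinates vanish at servers outside `R j.1 \ (S ∪ U)`, so the sum may run over all messages,
stored or not; at the remaining servers the shares are the true terms, not the placeholder zeros. -/
lemma answerSymbol_replicatedShare (v : (Σ n, Fin (d n)) → Fin L → F)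
    (a b : Msg K → Finset (Fin N) → Fin L → F) (c : Σ n, Fin (d n)) :
    answerSymbol R X T K v c.1 (fun j => replicatedShare b j.1 c.1)
      (fun j => replicatedShare a j.1 c.1) c.2 =
    ∑ j : Msg K, ∑ S ∈ (R j.1).powersetCard X, ∑ U ∈ (R j.1).powersetCard T,
      coordinates v (R j.1 \ (S ∪ U)) (a j S * b j U) c := by
  have h1 : ∀ j : MsgAt R K c.1, ∀ S U,
      coordinates v (R j.1.1 \ (S ∪ U)) (replicatedShare a j.1 c.1 S * replicatedShare b j.1 c.1 U)
        ⟨c.1, c.2⟩ = coordinates v (R j.1.1 \ (S ∪ U)) (a j.1 S * b j.1 U) c := by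
    intro j S U
    by_cases hc : c.1 ∈ S ∪ U
    · rw [coordinates_eq_zero _ (by simp_all), coordinates_eq_zero _ (by simp_all)]
    · rw [Finset.mem_union, not_or] at hc
      simp [replicatedShare, hc]
  unfold answerSymbol
  simp_rw [h1]
  rw [← Finset.sum_subtype (Finset.univ.filter fun j : Msg K => c.1 ∈ R j.1) (by simp)
    fun j => ∑ S ∈ (R j.1).powersetCard X, ∑ U ∈ (R j.1).powersetCard T,
      coordinates v (R j.1 \ (S ∪ U)) (a j S * b j U) c]
  refine Finset.sum_subset (Finset.filter_subset _ _) fun j _ hj => ?_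
  refine Finset.sum_eq_zero fun S _ => Finset.sum_eq_zero fun U _ => coordinates_eq_zero _ ?_
  simp_all

/-- Decoding. -/
lemma sum_answerSymbol_mul {v : (Σ n, Fin (d n)) → Fin L → F}
    (hv : ∀ m, ∀ S ∈ (R m).powersetCard X, ∀ U ∈ (R m).powersetCard T,
      SpansAt v (R m \ (S ∪ U)))
    (a b : Msg K → Finset (Fin N) → Fin L → F) (ℓ : Fin L) :
    ∑ c : Σ n, Fin (d n), answerSymbol R X T K v c.1 (fun j => replicatedShare b j.1 c.1)
      (fun j => replicatedShare a j.1 c.1) c.2 * v c ℓ =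
    linComb (replicatedSecret R T b) (replicatedSecret R X a) ℓ := by
  simp_rw [answerSymbol_replicatedShare, Finset.sum_mul]
  rw [Finset.sum_comm]
  refine Finset.sum_congr rfl fun j _ => ?_
  rw [Finset.sum_comm, replicatedSecret, replicatedSecret, Finset.sum_apply, Finset.sum_apply,
    mul_comm, Finset.sum_mul_sum]
  refine Finset.sum_congr rfl fun S hS => ?_
  rw [Finset.sum_comm]
  exact Finset.sum_congr rfl fun U hU => sum_coordinates (hv j.1 S hS U hU) _ ℓ

lemma linComb_eq_of_answers_eq {v : (Σ n, Fin (d n)) → Fin L → F}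
    (hv : ∀ m, ∀ S ∈ (R m).powersetCard X, ∀ U ∈ (R m).powersetCard T,
      SpansAt v (R m \ (S ∪ U)))
    {a b a' b' : Msg K → Finset (Fin N) → Fin L → F}
    (h : ∀ n, List.ofFn (answerSymbol R X T K v n (fun j => replicatedShare b j.1 n)
        (fun j => replicatedShare a j.1 n)) =
      List.ofFn (answerSymbol R X T K v n (fun j => replicatedShare b' j.1 n)
        (fun j => replicatedShare a' j.1 n))) :
    linComb (replicatedSecret R T b) (replicatedSecret R X a) =
      linComb (replicatedSecret R T b') (replicatedSecret R X a') := by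
  funext ℓ
  rw [← sum_answerSymbol_mul hv, ← sum_answerSymbol_mul hv]
  exact Finset.sum_congr rfl fun c _ => by rw [List.ofFn_injective (h c.1)]

open Classical in
/-- The scheme based on replicated secret sharing, in which server `n` sends `d n` symbols. -/
noncomputable def replicatedScheme (K : Fin M → ℕ) [Fintype F] (hXT : ∀ m, X + T < (R m).card)
    (v : (Σ n, Fin (d n)) → Fin L → F)
    (hv : ∀ m, ∀ S ∈ (R m).powersetCard X, ∀ U ∈ (R m).powersetCard T,
      SpansAt v (R m \ (S ∪ U))) : Scheme R X T K F L :=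
  have hX : ∀ m, X < (R m).card := fun m => by have := hXT m; omega
  have hT : ∀ m, T < (R m).card := fun m => by have := hXT m; omega
  { Ω := (Msg K → Finset (Fin N) → Fin L → F) × (Msg K → Finset (Fin N) → Fin L → F)
    p := PMF.uniformOfFintype _
    S := Finset (Fin N) → Fin L → F
    Q := Finset (Fin N) → Fin L → F
    W := fun ω => replicatedSecret R X ω.1
    lam := fun ω => replicatedSecret R T ω.2
    share := fun j n ω => replicatedShare ω.1 j n.1
    qshare := fun j n ω => replicatedShare ω.2 j n.1
    answer := fun n q s => List.ofFn (answerSymbol R X T K v n q s)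
    W_uniform := map_replicatedSecret (fun m => (hX m).le) (fun _ _ => rfl) Prod.fst_surjective
    lam_uniform := map_replicatedSecret (fun m => (hT m).le) (fun _ _ => rfl) Prod.snd_surjective
    W_recoverable := fun j => Determines.condEntropy_eq_zero fun ω ω' _ _ h =>
      replicatedSecret_eq_of_share_eq (hX j.1) fun n hn => congrFun h ⟨n, hn⟩
    lam_recoverable := fun j => Determines.condEntropy_eq_zero fun ω ω' _ _ h =>
      replicatedSecret_eq_of_share_eq (hT j.1) fun n hn => congrFun h ⟨n, hn⟩
    share_indep := entropy_replicatedShare (fun _ _ => rfl) Prod.fst_surjective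
    qshare_indep := entropy_replicatedShare (fun _ _ => rfl) Prod.snd_surjective
    secure := fun A hA =>
      mutualInfo_replicatedShare (fun m => (hX m).le) (fun _ _ => rfl) Prod.fst_surjective hA
    isPrivate := fun A hA =>
      mutualInfo_replicatedShare (fun m => (hT m).le) (fun _ _ => rfl) Prod.snd_surjective hA
    storage_indep := mutualInfo_replicatedShare_prod T Finset.univ
    answer_prefix_free := fun n x s s' h => h.eq_of_length (by simp)
    correct := Determines.condEntropy_eq_zero fun ω ω' _ _ h =>
      linComb_eq_of_answers_eq hv fun n => congrFun (Prod.ext_iff.1 h).1 n }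

lemma rate_replicatedScheme (K : Fin M → ℕ) [Fintype F] (hXT : ∀ m, X + T < (R m).card)
    (v : (Σ n, Fin (d n)) → Fin L → F)
    (hv : ∀ m, ∀ S ∈ (R m).powersetCard X, ∀ U ∈ (R m).powersetCard T,
      SpansAt v (R m \ (S ∪ U))) :
    (replicatedScheme K hXT v hv).rate = (L : ℝ≥0∞) / (∑ n, d n : ℕ) := by
  have h : (replicatedScheme K hXT v hv).download = (∑ n, d n : ℕ) := by
    have : ∀ ω n, ((replicatedScheme K hXT v hv).answer n
        (atServer (replicatedScheme K hXT v hv).qshare n ω)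
        (atServer (replicatedScheme K hXT v hv).share n ω)).length = d n := fun ω n =>
      List.length_ofFn
    unfold Scheme.download
    simp_rw [this]
    rw [← Finset.sum_mul, ← tsum_fintype (L := .unconditional _), PMF.tsum_coe, one_mul]
    simp
  rw [Scheme.rate, h]

end Achievability

/-! ### The linear program. -/

section LinearProgram

variable {N M : ℕ} {R : Fin M → Finset (Fin N)} {X T : ℕ}

lemma minReplication_le (R : Fin M → Finset (Fin N)) (m : Fin M) :
    minReplication R ≤ (R m).card :=
  ciInf_le (OrderBot.bddBelow _) m

lemma exists_card_eq_minReplication (hM : 0 < M) (R : Fin M → Finset (Fin N)) :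
    ∃ m, (R m).card = minReplication R := by
  have : Nonempty (Fin M) := ⟨⟨0, hM⟩⟩
  exact Nat.sInf_mem (Set.range_nonempty fun m => (R m).card)

/-- Nonnegativity extends the constraint to larger sets. This is needed because `S` and `U` may
overlap, which leaves more than `|R m| - X - T` servers. -/
lemma one_le_sum_of_mem_feasibleRegion {D : Fin N → ℝ} (hD : D ∈ feasibleRegion R X T)
    {m : Fin M} {A : Finset (Fin N)} (hA : A ⊆ R m) (hc : (R m).card ≤ A.card + X + T)
    (hXT : X + T ≤ (R m).card) : 1 ≤ ∑ n ∈ A, D n := by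
  obtain ⟨B, hB, hBc⟩ := Finset.exists_subset_card_eq
    (show (R m).card - X - T ≤ A.card by omega)
  exact (hD.2 m B (hB.trans hA) (by omega)).trans
    (Finset.sum_le_sum_of_subset_of_nonneg hB fun n _ _ => hD.1 n)

lemma one_le_sum_univ_of_mem_feasibleRegion (hM : 0 < M) (h : X + T < minReplication R)
    {D : Fin N → ℝ} (hD : D ∈ feasibleRegion R X T) : 1 ≤ ∑ n, D n :=
  (one_le_sum_of_mem_feasibleRegion hD subset_rfl (m := ⟨0, hM⟩) (by omega)
    (h.le.trans (minReplication_le R _))).trans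
    (Finset.sum_le_sum_of_subset_of_nonneg (Finset.subset_univ _) fun n _ _ => hD.1 n)

lemma isClosed_feasibleRegion : IsClosed (feasibleRegion R X T) := by
  have : feasibleRegion R X T = (⋂ n, {D : Fin N → ℝ | 0 ≤ D n}) ∩
      ⋂ (m) (A) (_ : A ⊆ R m) (_ : A.card + X + T = (R m).card),
        {D : Fin N → ℝ | 1 ≤ ∑ n ∈ A, D n} := by
    ext D
    simp [feasibleRegion]
  rw [this]
  refine (isClosed_iInter fun n => isClosed_le continuous_const (continuous_apply n)).inter ?_
  refine isClosed_iInter fun m => isClosed_iInter fun A => isClosed_iInter fun _ =>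
    isClosed_iInter fun _ => isClosed_le continuous_const ?_
  exact continuous_finsetSum _ fun n _ => continuous_apply n

/-- The linear program has an optimal solution. -/
lemma exists_isMinOn_feasibleRegion (h : X + T < minReplication R) :
    ∃ D ∈ feasibleRegion R X T, ∀ D' ∈ feasibleRegion R X T, ∑ n, D n ≤ ∑ n, D' n := by
  have hone : (fun _ => 1 : Fin N → ℝ) ∈ feasibleRegion R X T := by
    refine ⟨fun _ => zero_le_one, fun m A _ hc => ?_⟩
    have := minReplication_le R m
    rw [Finset.sum_const, nsmul_eq_mul, mul_one]
    exact_mod_cast (show 1 ≤ A.card by omega)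
  -- The all-ones point is feasible with value `N`, so only points with coordinates at most `N`
  -- matter.
  have hcomp : IsCompact (feasibleRegion R X T ∩ Set.Icc 0 fun _ => (N : ℝ)) :=
    isCompact_Icc.inter_left isClosed_feasibleRegion
  have hcont : Continuous fun D : Fin N → ℝ => ∑ n, D n :=
    continuous_finsetSum _ fun n _ => continuous_apply n
  by_cases hN : N = 0
  · subst hN
    exact ⟨_, hone, fun D' _ => by simp⟩
  have hone' : (fun _ => 1 : Fin N → ℝ) ∈ feasibleRegion R X T ∩ Set.Icc 0 fun _ => (N : ℝ) :=
    ⟨hone, fun _ => zero_le_one, fun _ =>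
      Nat.one_le_cast.2 (Nat.one_le_iff_ne_zero.2 hN)⟩
  obtain ⟨D, hD, hmin⟩ := hcomp.exists_isMinOn ⟨_, hone'⟩ hcont.continuousOn
  refine ⟨D, hD.1, fun D' hD' => ?_⟩
  by_cases hle : ∑ n, D' n ≤ N
  · refine hmin (show D' ∈ _ from ⟨hD', hD'.1, fun n => ?_⟩)
    exact (Finset.single_le_sum (fun n _ => hD'.1 n) (Finset.mem_univ n)).trans hle
  · have h1 : ∑ n, D n ≤ ∑ _n : Fin N, (1 : ℝ) := hmin hone'
    simp only [Finset.sum_const, Finset.card_univ, Fintype.card_fin, nsmul_eq_mul, mul_one] at h1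
    linarith

end LinearProgram

/-! ### Capacity bounds and their limits. -/

section Capacity

variable {N M : ℕ} {R : Fin M → Finset (Fin N)} {X T : ℕ} {K : Fin M → ℕ}

/-- The hypothesis with `0 < L` also rules out a zero download, for which the rate would be
infinite. -/
lemma Scheme.rate_le_ofReal {F : Type} [Field F] [Fintype F] {L : ℕ} (s : Scheme R X T K F L)
    {c : ℝ} (hc : 0 ≤ c) (hL : 0 < L) (h : (L : ℝ) ≤ c * ∑ n, s.serverDownload n) :
    s.rate ≤ ENNReal.ofReal c := by
  have hL' : (0 : ℝ) < L := by exact_mod_cast hL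
  have hD : 0 < ∑ n, s.serverDownload n :=
    pos_of_mul_pos_right (hL'.trans_le h) hc
  rw [Scheme.rate, s.download_eq, ← ENNReal.ofReal_natCast, ← ENNReal.ofReal_div_of_pos hD]
  exact ENNReal.ofReal_le_ofReal ((div_le_iff₀ hD).2 h)

lemma capacity_le {c : ℝ≥0∞}
    (h : ∀ (F : Type) [Field F] [Fintype F] (L : ℕ), 0 < L → ∀ s : Scheme R X T K F L,
      s.rate ≤ c) : capacity R X T K ≤ c := by
  unfold capacity
  refine iSup_le fun F => iSup_le fun _ => iSup_le fun _ => iSup_le fun L => iSup_le fun hL =>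
    iSup_le fun s => h F L hL s

lemma Scheme.rate_le_capacity {F : Type} [hF : Field F] [hF' : Fintype F] {L : ℕ} (hL : 0 < L)
    (s : Scheme R X T K F L) : s.rate ≤ capacity R X T K := by
  unfold capacity
  exact le_iSup_of_le F <| le_iSup_of_le hF <| le_iSup_of_le hF' <| le_iSup_of_le L <|
    le_iSup_of_le hL <| le_iSup_of_le s le_rfl

/-- A set of servers is covered by a set of `X` and a set of `T` servers, except for
`|A| - X - T` of its elements. -/
lemma exists_cover {A C : Finset (Fin N)} (hCA : C ⊆ A) (hX : X ≤ N) (hT : T ≤ N)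
    (h : A.card ≤ C.card + X + T) :
    ∃ B B' : Finset (Fin N), B.card = X ∧ B'.card = T ∧ A ⊆ B ∪ B' ∪ C := by
  -- The `X`-set absorbs as much of `A \ C` as it can; at most `T` elements remain. Both sets are
  -- then padded to their exact sizes.
  obtain ⟨E, hE, hEc⟩ := Finset.exists_subset_card_eq
    (show min X (A \ C).card ≤ (A \ C).card from min_le_right _ _)
  have h1 := Finset.card_sdiff_add_card_eq_card hCA
  have h2 := Finset.card_sdiff_add_card_eq_card hE
  obtain ⟨B, hEB, -, hB⟩ := Finset.exists_subsuperset_card_eq (Finset.subset_univ E)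
    (n := X) (by omega) (by simpa using hX)
  obtain ⟨B', hEB', -, hB'⟩ := Finset.exists_subsuperset_card_eq
    (Finset.subset_univ ((A \ C) \ E)) (n := T) (by omega) (by simpa using hT)
  refine ⟨B, B', hB, hB', fun n hn => ?_⟩
  by_cases hC : n ∈ C
  · simp [hC]
  · by_cases hnE : n ∈ E
    · simp [hEB hnE]
    · simp [hEB' (show n ∈ (A \ C) \ E by simp [hn, hC, hnE])]

lemma Scheme.le_sum_serverDownload {F : Type} [Field F] [Fintype F] {L : ℕ}
    (s : Scheme R X T K F L) (hX : X < N) (hT : 1 ≤ T) (hTN : T < N) {m : Fin M}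
    {C : Finset (Fin N)} (hC : C ⊆ R m) (h : (R m).card ≤ C.card + X + T) {k : ℕ} (hk : 0 < k)
    (hkm : k ≤ K m) :
    (L : ℝ) ≤ ∑ n ∈ C, s.serverDownload n + (k : ℝ)⁻¹ * ∑ n, s.serverDownload n := by
  obtain ⟨B, B', hB, hB', hcov⟩ := exists_cover hC hX.le hTN.le h
  have h1 := s.converse_bound hT hTN m hcov hB hB'
  have h2 : ∑ n ∈ B', s.serverDownload n ≤ ∑ n, s.serverDownload n :=
    Finset.sum_le_sum_of_subset_of_nonneg (Finset.subset_univ _)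
      fun n _ _ => s.serverDownload_nonneg n
  have h0 : 0 ≤ ∑ n, s.serverDownload n := Finset.sum_nonneg fun n _ => s.serverDownload_nonneg n
  have hk' : (0 : ℝ) < k := by exact_mod_cast hk
  have hkm' : (k : ℝ) ≤ K m := by exact_mod_cast hkm
  have hK : (0 : ℝ) < K m := hk'.trans_le hkm'
  have h3 : (L : ℝ) ≤ ∑ n ∈ C, s.serverDownload n +
      (K m : ℝ)⁻¹ * ∑ n, s.serverDownload n := by
    refine le_of_mul_le_mul_left ?_ hK
    rw [mul_add, mul_inv_cancel_left₀ hK.ne']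
    linarith
  have h4 : (K m : ℝ)⁻¹ ≤ (k : ℝ)⁻¹ := inv_anti₀ hk' hkm'
  have := mul_le_mul_of_nonneg_right h4 h0
  linarith

lemma capacity_le_of_minReplication_le (hM : 0 < M) (hX : X < N) (hT : 1 ≤ T) (hTN : T < N)
    (h : minReplication R ≤ X + T) {k : ℕ} (hk : 0 < k) (hK : ∀ m, k ≤ K m) :
    capacity R X T K ≤ ENNReal.ofReal (k : ℝ)⁻¹ := by
  obtain ⟨m, hm⟩ := exists_card_eq_minReplication hM R
  refine capacity_le fun F _ _ L hL s => s.rate_le_ofReal (by positivity) hL ?_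
  have := s.le_sum_serverDownload hX hT hTN (Finset.empty_subset (R m)) (by simp; omega) hk (hK m)
  simpa using this

lemma capacity_le_of_lt_minReplication (hX : X < N) (hT : 1 ≤ T) (hTN : T < N) {v : ℝ}
    (hv : 0 < v) (hmin : ∀ D ∈ feasibleRegion R X T, v ≤ ∑ n, D n) {k : ℕ} (hk : 0 < k)
    (hK : ∀ m, k ≤ K m) :
    capacity R X T K ≤ ENNReal.ofReal (v⁻¹ + (k : ℝ)⁻¹) := by
  refine capacity_le fun F _ _ L hL s => s.rate_le_ofReal (by positivity) hL ?_
  set t := ∑ n, s.serverDownload n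
  have ht : 0 ≤ t := Finset.sum_nonneg fun n _ => s.serverDownload_nonneg n
  rw [add_mul]
  by_cases hlt : (L : ℝ) ≤ (k : ℝ)⁻¹ * t
  · have : 0 ≤ v⁻¹ * t := by positivity
    linarith
  · rw [not_le] at hlt
    -- Every constraint set `C` downloads at least `e`, so dividing the downloads by `e` gives a
    -- feasible point.
    set e := L - (k : ℝ)⁻¹ * t with he
    have he0 : 0 < e := sub_pos.2 hlt
    have hfeas : (fun n => s.serverDownload n / e) ∈ feasibleRegion R X T := by
      refine ⟨fun n => div_nonneg (s.serverDownload_nonneg n) he0.le, fun m C hC hc => ?_⟩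
      have := s.le_sum_serverDownload hX hT hTN hC hc.ge hk (hK m)
      rw [← Finset.sum_div, one_le_div he0]
      linarith
    have := hmin _ hfeas
    rw [← Finset.sum_div, le_div_iff₀ he0] at this
    have h2 : e ≤ v⁻¹ * t := by
      rw [← div_eq_inv_mul, le_div_iff₀ hv]
      linarith
    linarith

lemma le_capacity (hXT : X + T < minReplication R) {D : Fin N → ℝ}
    (hD : D ∈ feasibleRegion R X T) {L : ℕ} (hL : 0 < L) :
    (L : ℝ≥0∞) / (∑ n, ⌈L * D n⌉₊ : ℕ) ≤ capacity R X T K := by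
  set d : Fin N → ℕ := fun n => ⌈L * D n⌉₊
  have hL' : (0 : ℝ) < L := by exact_mod_cast hL
  have hρ : ∀ m, X + T < (R m).card := fun m => hXT.trans_le (minReplication_le R m)
  -- The field must provide a distinct evaluation point for every transmitted symbol.
  obtain ⟨q, hq, hprime⟩ := Nat.exists_infinite_primes (Fintype.card (Σ n, Fin (d n)))
  have : Fact q.Prime := ⟨hprime⟩
  obtain ⟨x⟩ : Nonempty ((Σ n, Fin (d n)) ↪ ZMod q) :=
    Function.Embedding.nonempty_of_card_le (by rwa [ZMod.card])
  have hv : ∀ m, ∀ S ∈ (R m).powersetCard X, ∀ U ∈ (R m).powersetCard T,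
      SpansAt (fun a (ℓ : Fin L) => x a ^ (ℓ : ℕ)) (R m \ (S ∪ U)) := fun m S hS U hU => by
    refine spansAt_vandermonde x.injective ?_
    rw [Finset.mem_powersetCard] at hS hU
    have h1 := Finset.card_sdiff_add_card_eq_card (Finset.union_subset hS.1 hU.1)
    have h2 := Finset.card_union_le S U
    have h3 := one_le_sum_of_mem_feasibleRegion hD
      (Finset.sdiff_subset : R m \ (S ∪ U) ⊆ R m) (by omega) (hρ m).le
    have h4 : (L : ℝ) ≤ ∑ n ∈ R m \ (S ∪ U), (d n : ℝ) :=
      calc (L : ℝ) ≤ L * ∑ n ∈ R m \ (S ∪ U), D n := le_mul_of_one_le_right hL'.le h3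
        _ = ∑ n ∈ R m \ (S ∪ U), L * D n := Finset.mul_sum _ _ _
        _ ≤ _ := Finset.sum_le_sum fun n _ => Nat.le_ceil _
    exact_mod_cast h4
  rw [← rate_replicatedScheme K hρ _ hv]
  exact Scheme.rate_le_capacity hL _

lemma ofReal_inv_le_capacity (hM : 0 < M) (hXT : X + T < minReplication R) {D : Fin N → ℝ}
    (hD : D ∈ feasibleRegion R X T) : ENNReal.ofReal (∑ n, D n)⁻¹ ≤ capacity R X T K := by
  set v := ∑ n, D n
  have hv : 1 ≤ v := one_le_sum_univ_of_mem_feasibleRegion hM hXT hD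
  have hv0 : 0 < v := by linarith
  -- Rounding up costs at most one symbol per server, whence `N / L` after division by `L`.
  have hlim : Tendsto (fun L : ℕ => ENNReal.ofReal (v + N / (L : ℝ))⁻¹) atTop
      (𝓝 (ENNReal.ofReal v⁻¹)) := by
    refine ENNReal.tendsto_ofReal (Tendsto.inv₀ ?_ hv0.ne')
    simpa using tendsto_const_nhds.add (tendsto_const_div_atTop_nhds_zero_nat (N : ℝ))
  refine le_of_tendsto hlim ((eventually_gt_atTop 0).mono fun L hL => ?_)
  have hL' : (0 : ℝ) < L := by exact_mod_cast hL
  refine le_trans ?_ (le_capacity hXT hD hL)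
  have hle : ((∑ n, ⌈L * D n⌉₊ : ℕ) : ℝ) ≤ L * (v + N / L) := by
    rw [Nat.cast_sum, mul_add, mul_div_cancel₀ _ hL'.ne', Finset.mul_sum]
    calc ∑ n, (⌈L * D n⌉₊ : ℝ) ≤ ∑ n, (L * D n + 1) := Finset.sum_le_sum fun n _ =>
          (Nat.ceil_lt_add_one (mul_nonneg hL'.le (hD.1 n))).le
      _ = _ := by rw [Finset.sum_add_distrib]; simp
  have hge : L * v ≤ ((∑ n, ⌈L * D n⌉₊ : ℕ) : ℝ) := by
    rw [Nat.cast_sum, Finset.mul_sum]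
    exact Finset.sum_le_sum fun n _ => Nat.le_ceil _
  have hpos : (0 : ℝ) < ((∑ n, ⌈L * D n⌉₊ : ℕ) : ℝ) := (mul_pos hL' hv0).trans_le hge
  rw [← ENNReal.ofReal_natCast L, ← ENNReal.ofReal_natCast (∑ n, ⌈L * D n⌉₊),
    ← ENNReal.ofReal_div_of_pos hpos]
  refine ENNReal.ofReal_le_ofReal ?_
  rw [le_div_iff₀ hpos, ← div_eq_inv_mul, div_le_iff₀ (by positivity)]
  exact hle

lemma eventually_forall_le (M k : ℕ) : ∀ᶠ K : Fin M → ℕ in atTop, ∀ m, k ≤ K m :=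
  (eventually_ge_atTop fun _ => k).mono fun _ h => h

lemma tendsto_inv_natCast_add (c : ℝ) :
    Tendsto (fun k : ℕ => ENNReal.ofReal (c + (k : ℝ)⁻¹)) atTop (𝓝 (ENNReal.ofReal c)) := by
  refine ENNReal.tendsto_ofReal ?_
  simpa using tendsto_const_nhds.add (tendsto_inv_atTop_nhds_zero_nat (𝕜 := ℝ))

/-- A function squeezed between `c` and `c + 1 / min K` tends to `c`. -/
lemma tendsto_of_le_ofReal_add_inv {f : (Fin M → ℕ) → ℝ≥0∞} {c : ℝ}
    (hl : ∀ K, ENNReal.ofReal c ≤ f K)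
    (hu : ∀ k : ℕ, 0 < k → ∀ K : Fin M → ℕ, (∀ m, k ≤ K m) →
      f K ≤ ENNReal.ofReal (c + (k : ℝ)⁻¹)) :
    Tendsto f atTop (𝓝 (ENNReal.ofReal c)) := by
  refine tendsto_order.2 ⟨fun a ha => Eventually.of_forall fun K => ha.trans_le (hl K),
    fun a ha => ?_⟩
  obtain ⟨k, hka, hk⟩ := (((tendsto_order.1 (tendsto_inv_natCast_add c)).2 a ha).and
    (eventually_gt_atTop 0)).exists
  exact (eventually_forall_le M k).mono fun K hK => (hu k hk K hK).trans_lt hka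

end Capacity

end GXSTPLC

theorem theorem1 {N M : ℕ} (hM : 0 < M) (R : Fin M → Finset (Fin N))
    (hR : ∀ m, (R m).Nonempty) (X T : ℕ) (hX : X < N) (hT : 1 ≤ T) (hTN : T < N) :
    (GXSTPLC.minReplication R ≤ X + T →
      Tendsto (fun K : Fin M → ℕ => GXSTPLC.capacity R X T K) atTop (𝓝 0)) ∧
    (X + T < GXSTPLC.minReplication R →
      ∃ c : ℝ,
        IsGreatest ((fun D : Fin N → ℝ => (∑ n, D n)⁻¹) '' GXSTPLC.feasibleRegion R X T) c ∧
        Tendsto (fun K : Fin M → ℕ => GXSTPLC.capacity R X T K) atTop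
          (𝓝 (ENNReal.ofReal c))) := by
  refine ⟨fun h => ?_, fun h => ?_⟩
  · rw [← ENNReal.ofReal_zero]
    refine GXSTPLC.tendsto_of_le_ofReal_add_inv (fun K => by simp) fun k hk K hK => ?_
    rw [zero_add]
    exact GXSTPLC.capacity_le_of_minReplication_le hM hX hT hTN h hk hK
  · obtain ⟨D, hD, hmin⟩ := GXSTPLC.exists_isMinOn_feasibleRegion h
    have hpos : 0 < ∑ n, D n :=
      zero_lt_one.trans_le (GXSTPLC.one_le_sum_univ_of_mem_feasibleRegion hM h hD)
    refine ⟨(∑ n, D n)⁻¹, ⟨⟨D, hD, rfl⟩, ?_⟩, ?_⟩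
    · rintro _ ⟨D', hD', rfl⟩
      exact inv_anti₀ hpos (hmin D' hD')
    · exact GXSTPLC.tendsto_of_le_ofReal_add_inv
        (fun K => GXSTPLC.ofReal_inv_le_capacity hM h hD)
        fun k hk K hK => GXSTPLC.capacity_le_of_lt_minReplication hX hT hTN hpos hmin hk hK
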